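/- **Proposition 1.1 (fusion principle).** Let $Y_1\subset Y_2\subset Y_3$ be compact smooth manifolds with boundary of the same dimension $n$, such that $Y_1\subset \mathring{Y}_2$ and $Y_2\subset\mathring{Y}_3$ ($Y_1$ and $Y_2$ being smoothly embedded in $Y_3$), and let $F$ be a flat complex vector bundle of rank $r$ on $Y_3$. Denote by $H^\cdot(Y_k,F)$ and $H^\cdot(Y_k,Y_j,F)$ $(j<k)$ the absolute and relative cohomologies with coefficients in $F$; they are finite-dimensional and vanish in degrees $>n$. For a finite-dimensional complex vector space $W$ put $\det W=\Lambda^{\dim W}W$, and for a finite-dimensional graded space $E^\cdot$ put $\det E^\cdot=\bigotimes_i(\det E^i)^{(-1)^i}$, where the inverse of a line is its dual. For a triple $P\subset Q\subset R$ taken among $\varnothing,Y_1,Y_2,Y_3$, the long exact sequence $$\cdots\to H^i(R,Q,F)\to H^i(R,P,F)\to H^i(Q,P,F)\to H^{i+1}(R,Q,F)\to\cdots$$ is an acyclic complex of finite-dimensional vector spaces. An acyclic complex $(C^\cdot,d)$ has a canonical generator of its determinant line, namely $\bigotimes_k\big(\bigwedge_j ds^{k-1}_j\wedge\bigwedge_j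 s^k_j\big)^{(-1)^k}$, where $(s^k_j)_j$ in $C^k$ projects to a basis of $C^k/dC^{k-1}$. The generator of the long exact sequence defines an isomorphism of lines $$\det H^\cdot(Q,P,F)\otimes\det H^\cdot(R,Q,F)\simeq\det H^\cdot(R,P,F).$$ Write $f_{1,21}$, $f_{2,32}$, $f_{1,31}$, $f_{21,32}$ for these isomorphisms for the triples $(\varnothing,Y_1,Y_2)$, $(\varnothing,Y_2,Y_3)$, $(\varnothing,Y_1,Y_3)$, $(Y_1,Y_2,Y_3)$ respectively. Then there is $\mu\in\mathbf C$ with $|\mu|=1$ such that $$f_{2,32}\circ(f_{1,21}\otimes\mathrm{id})=\mu\, f_{1,31}\circ(\mathrm{id}\otimes f_{21,32})$$ as isomorphisms $\det H^\cdot(Y_1,F)\otimes\det H^\cdot(Y_2,Y_1,F)\otimes\det H^\cdot(Y_3,Y_2,F)\simeq\det H^\cdot(Y_3,F)$. -/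

import Mathlib

open CategoryTheory Filter Topology Set
open scoped Manifold ContDiff TensorProduct

/-- A flat complex vector bundle of rank `r` on `X`: a complex vector bundle (given by an open
cover, indexed by `ι`, and a cocycle of transition functions with values in `GL_r(ℂ)`) whose
transition functions are locally constant. The fibre at `x` is `F.Fiber x`. -/
structure FlatVectorBundle (X : Type*) [TopologicalSpace X] (r : ℕ) (ι : Type*)
    extends VectorBundleCore ℂ X (Fin r → ℂ) ι where
  flat : ∀ i j, ∀ x ∈ baseSet i ∩ baseSet j, ∀ᶠ y in 𝓝 x, coordChange i j y = coordChange i j x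

namespace FlatVectorBundle

/-- The fibre of a flat vector bundle at a point. -/
abbrev Fiber {X : Type*} [TopologicalSpace X] {r : ℕ} {ι : Type*} (F : FlatVectorBundle X r ι)
    (x : X) : Type :=
  F.toVectorBundleCore.Fiber x

section Sections

variable {X S T : Type*} [TopologicalSpace X] [TopologicalSpace S] [TopologicalSpace T]
  {r : ℕ} {ι : Type*} (F : FlatVectorBundle X r ι)

/-- The coordinates of a vector of the fibre `F_x` in the `i`-th local frame. -/
noncomputable def coord (i : ι) (x : X) : F.Fiber x →ₗ[ℂ] (Fin r → ℂ) where
  toFun v := F.coordChange (F.indexAt x) i x v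
  map_add' v w := (F.coordChange (F.indexAt x) i x).map_add v w
  map_smul' c v := (F.coordChange (F.indexAt x) i x).map_smul c v

theorem coord_injective (i : ι) (x : X) (hx : x ∈ F.baseSet i) :
    Function.Injective (F.coord i x) := by
  intro v w h
  have hm := F.mem_baseSet_at x
  have h5 : F.coordChange i (F.indexAt x) x (F.coordChange (F.indexAt x) i x v) =
      F.coordChange i (F.indexAt x) x (F.coordChange (F.indexAt x) i x w) :=
    congrArg (F.coordChange i (F.indexAt x) x) h
  have e : ∀ u, F.coordChange i (F.indexAt x) x (F.coordChange (F.indexAt x) i x u) = u := fun u =>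
    (F.coordChange_comp _ _ _ _ ⟨⟨hm, hx⟩, hm⟩ u).trans (F.coordChange_self _ _ hm u)
  exact (e v).symm.trans (h5.trans (e w))

/-- The space of flat (that is, locally constant) sections of the pull-back `g^* F` of a flat
vector bundle by a continuous map `g : T → X`: in every local flat frame, the coordinates of the
section are locally constant. -/
noncomputable def flatSections (g : C(T, X)) : Submodule ℂ (∀ t, F.Fiber (g t)) where
  carrier := {s | ∀ (i : ι) (t : T), g t ∈ F.baseSet i →
    ∀ᶠ t' in 𝓝 t, F.coord i (g t') (s t') = F.coord i (g t) (s t)}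
  add_mem' := by
    intro a b ha hb i t ht
    filter_upwards [ha i t ht, hb i t ht] with t' h1 h2
    rw [Pi.add_apply, Pi.add_apply, map_add, map_add, h1, h2]
  zero_mem' := by
    intro i t ht
    refine Eventually.of_forall fun t' => ?_
    rw [Pi.zero_apply, Pi.zero_apply, map_zero, map_zero]
  smul_mem' := by
    intro c a ha i t ht
    filter_upwards [ha i t ht] with t' h1
    rw [Pi.smul_apply, Pi.smul_apply, map_smul, map_smul, h1]

/-- Pull-back of flat sections along a continuous map `h : S → T`. -/
noncomputable def pullback (g : C(T, X)) (h : C(S, T)) : F.flatSections g →ₗ[ℂ] F.flatSections (g.comp h) where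
  toFun s := ⟨fun t => s.1 (h t), fun i t ht =>
    (h.continuous.tendsto t).eventually (s.2 i (h t) ht)⟩
  map_add' _ _ := rfl
  map_smul' _ _ := rfl

/-- The fibre bundle with fibre `ℂ^r`, equipped with the discrete topology, that underlies a flat
vector bundle. Its projection is a covering map. -/
noncomputable def discreteCore : letI : TopologicalSpace (Fin r → ℂ) := ⊥; FiberBundleCore ι X (Fin r → ℂ) :=
  letI : TopologicalSpace (Fin r → ℂ) := ⊥
  { baseSet := F.baseSet
    isOpen_baseSet := F.isOpen_baseSet
    indexAt := F.indexAt
    mem_baseSet_at := F.mem_baseSet_at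
    coordChange := fun i j x v => F.coordChange i j x v
    coordChange_self := F.coordChange_self
    coordChange_comp := F.coordChange_comp
    continuousOn_coordChange := by
      intro i j p hp
      have : DiscreteTopology (Fin r → ℂ) := ⟨rfl⟩
      refine ContinuousAt.continuousWithinAt ?_
      have h1 : ∀ᶠ q : X × (Fin r → ℂ) in 𝓝 p, F.coordChange i j q.1 = F.coordChange i j p.1 :=
        (continuous_fst.tendsto p).eventually (F.flat i j p.1 hp.1)
      have h2 : ∀ᶠ q : X × (Fin r → ℂ) in 𝓝 p, q.2 = p.2 :=
        (continuous_snd.tendsto p).eventually (show ∀ᶠ w in 𝓝 p.2, w = p.2 by rw [nhds_discrete]; exact rfl)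
      refine (continuousAt_const (y := F.coordChange i j p.1 p.2)).congr ?_
      filter_upwards [h1, h2] with q hq1 hq2
      rw [hq1, hq2] }

theorem flatSections_ext [PreconnectedSpace T] (g : C(T, X)) (t₀ : T)
    (s s' : F.flatSections g) (h : s.1 t₀ = s'.1 t₀) : s = s' := by
  have key : IsClopen {t : T | s.1 t = s'.1 t} := by
    have hloc : ∀ t : T, ∀ᶠ t' in 𝓝 t, (s.1 t' = s'.1 t' ↔ s.1 t = s'.1 t) := by
      intro t
      have hm := F.mem_baseSet_at (g t)
      have hb : ∀ᶠ t' in 𝓝 t, g t' ∈ F.baseSet (F.indexAt (g t)) :=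
        (g.continuous.tendsto t).eventually ((F.isOpen_baseSet _).mem_nhds hm)
      filter_upwards [s.2 _ t hm, s'.2 _ t hm, hb] with t' h1 h2 h3
      constructor
      · intro he
        rw [he] at h1
        exact F.coord_injective _ _ hm (h1.symm.trans h2)
      · intro he
        rw [he] at h1
        exact F.coord_injective _ _ h3 (h1.trans h2.symm)
    constructor
    · rw [← isOpen_compl_iff, isOpen_iff_mem_nhds]
      intro t ht
      filter_upwards [hloc t] with t' h1 h2
      exact ht (h1.1 h2)
    · rw [isOpen_iff_mem_nhds]
      intro t ht
      filter_upwards [hloc t] with t' h1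
      exact h1.2 ht
  have huniv := key.eq_univ ⟨t₀, h⟩
  apply Subtype.ext
  funext t
  exact (huniv ▸ mem_univ t : t ∈ {t : T | s.1 t = s'.1 t})

theorem exists_flatSection [SimplyConnectedSpace T] [LocallyPathConnectedSpace T]
    (g : C(T, X)) (t₀ : T) (v : F.Fiber (g t₀)) : ∃ s : F.flatSections g, s.1 t₀ = v := by
  let _ : TopologicalSpace (Fin r → ℂ) := ⊥
  have : DiscreteTopology (Fin r → ℂ) := ⟨rfl⟩
  have hcov : IsCoveringMap (Bundle.TotalSpace.proj : (F.discreteCore).TotalSpace → X) :=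
    FiberBundle.isCoveringMap (F := Fin r → ℂ) (E := F.discreteCore.Fiber)
  obtain ⟨Γ, ⟨hΓ0, hΓ⟩, -⟩ := hcov.existsUnique_continuousMap_lifts g t₀ ⟨g t₀, v⟩ rfl
  have hp : ∀ t, (Γ t).1 = g t := fun t => congrFun hΓ t
  have hs : ∃ s : ∀ t, F.Fiber (g t), ∀ t, Γ t = ⟨g t, s t⟩ := by
    have : ∀ t, ∃ w : F.Fiber (g t), Γ t = ⟨g t, w⟩ := by
      intro t
      have h := hp t
      generalize Γ t = e at h
      obtain ⟨x, w⟩ := e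
      subst h
      exact ⟨w, rfl⟩
    choose s hs using this
    exact ⟨s, hs⟩
  obtain ⟨s, hs⟩ := hs
  refine ⟨⟨s, ?_⟩, ?_⟩
  · intro i t ht
    have hsrc : Γ t ∈ (F.discreteCore.localTriv i).source := by
      rw [F.discreteCore.mem_localTriv_source, hs t]
      exact ht
    have hc : ContinuousAt (fun t' => (F.discreteCore.localTriv i (Γ t')).2) t :=
      (continuous_snd.continuousAt).comp
        (((F.discreteCore.localTriv i).continuousAt hsrc).comp Γ.continuous.continuousAt)
    have := hc.tendsto.eventually (show ∀ᶠ w in 𝓝 _, w = _ by rw [nhds_discrete]; exact rfl)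
    filter_upwards [this] with t' h
    rw [hs t', hs t] at h
    exact h
  · have h1 := hs t₀
    rw [hΓ0] at h1
    have h2 : HEq v (s t₀) := (Bundle.TotalSpace.mk.inj h1).2
    exact (eq_of_heq h2).symm

theorem pullback_bijective [SimplyConnectedSpace T] [LocallyPathConnectedSpace T]
    [SimplyConnectedSpace S] (g : C(T, X)) (h : C(S, T)) :
    Function.Bijective (F.pullback g h) := by
  obtain ⟨s₀⟩ : Nonempty S := inferInstance
  constructor
  · intro a b hab
    exact F.flatSections_ext g (h s₀) a b (congrFun (congrArg Subtype.val hab) s₀)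
  · intro a
    obtain ⟨b, hb⟩ := F.exists_flatSection g (h s₀) (a.1 s₀)
    exact ⟨b, F.flatSections_ext (g.comp h) s₀ _ _ hb⟩

/-- On simply connected spaces, a flat section of `(g ∘ h)^* F` is the pull-back of a unique flat
section of `g^* F`; `F.extend g h` maps the former to the latter (parallel transport). -/
noncomputable def extend [SimplyConnectedSpace T] [LocallyPathConnectedSpace T]
    [SimplyConnectedSpace S] (g : C(T, X)) (h : C(S, T)) :
    F.flatSections (g.comp h) ≃ₗ[ℂ] F.flatSections g :=
  (LinearEquiv.ofBijective (F.pullback g h) (F.pullback_bijective g h)).symm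

theorem extend_eq_iff [SimplyConnectedSpace T] [LocallyPathConnectedSpace T]
    [SimplyConnectedSpace S] (g : C(T, X)) (h : C(S, T)) (a : F.flatSections (g.comp h))
    (b : F.flatSections g) : F.extend g h a = b ↔ a = F.pullback g h b := by
  unfold extend
  rw [LinearEquiv.symm_apply_eq]
  rfl

end Sections


section Cohomology

/-- The standard topological simplex of dimension `k`. -/
abbrev TopSimplex (k : SimplexCategory) : Type := stdSimplex ℝ (Fin (k.len + 1))

instance (k : SimplexCategory) : SimplyConnectedSpace (TopSimplex k) :=
  have : ContractibleSpace (TopSimplex k) :=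
    (convex_stdSimplex ℝ (Fin (k.len + 1))).contractibleSpace ⟨_, single_mem_stdSimplex ℝ (0 : Fin (k.len + 1))⟩
  inferInstance

instance (k : SimplexCategory) : LocallyPathConnectedSpace (TopSimplex k) :=
  (convex_stdSimplex ℝ (Fin (k.len + 1))).locallyPathConnectedSpace

/-- The affine map of standard simplices induced by a monotone map of vertices. -/
noncomputable def simplexMap {k l : SimplexCategory} (φ : k ⟶ l) : C(TopSimplex k, TopSimplex l) :=
  ⟨stdSimplex.map φ, stdSimplex.continuous_map φ⟩

theorem simplexMap_id (k : SimplexCategory) : simplexMap (𝟙 k) = ContinuousMap.id _ := by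
  ext1 x
  exact stdSimplex.map_id_apply x

theorem simplexMap_comp {k l m : SimplexCategory} (φ : k ⟶ l) (ψ : l ⟶ m) :
    simplexMap (φ ≫ ψ) = (simplexMap ψ).comp (simplexMap φ) := by
  ext1 x
  exact (stdSimplex.map_comp_apply φ ψ x).symm

universe u

variable {X : Type u} [TopologicalSpace X]

/-- The singular simplices of the subspace `Q` of `X`. -/
abbrev SingularSimplex (Q : Set X) (k : SimplexCategory) : Type u :=
  {σ : C(TopSimplex k, X) // ∀ t, σ t ∈ Q}

/-- The face (or degeneracy) of a singular simplex given by a monotone map of vertices. -/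
noncomputable def SingularSimplex.face {Q : Set X} {k l : SimplexCategory} (σ : SingularSimplex Q l)
    (φ : k ⟶ l) : SingularSimplex Q k :=
  ⟨σ.1.comp (simplexMap φ), fun t => σ.2 (simplexMap φ t)⟩

variable {r : ℕ} {ι : Type*} (F : FlatVectorBundle X r ι)

/-- Singular `k`-cochains of the pair `(Q, P)` of subspaces of `X` with coefficients in the flat
vector bundle `F`: such a cochain assigns to each singular simplex `σ : Δ^k → Q` a flat section of
`σ^* F` (equivalently, an element of the fibre of `F` at a vertex of `σ`), and zero to the
simplices that lie in `P`. -/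
noncomputable def cochains (Q P : Set X) (k : SimplexCategory) :
    Submodule ℂ (∀ σ : SingularSimplex Q k, F.flatSections σ.1) where
  carrier := {c | ∀ σ : SingularSimplex Q k, (∀ t, σ.1 t ∈ P) → c σ = 0}
  add_mem' := by
    intro a b ha hb σ hσ
    rw [Pi.add_apply, ha σ hσ, hb σ hσ, add_zero]
  zero_mem' := fun _ _ => rfl
  smul_mem' := by
    intro c a ha σ hσ
    rw [Pi.smul_apply, ha σ hσ, smul_zero]

/-- The extension of a flat section on a face of a singular simplex to the whole simplex. -/
noncomputable def extendFace {Q : Set X} {k l : SimplexCategory} (σ : SingularSimplex Q l)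
    (φ : k ⟶ l) : F.flatSections (σ.face φ).1 ≃ₗ[ℂ] F.flatSections σ.1 :=
  F.extend σ.1 (simplexMap φ)

/-- The map on cochains induced by a monotone map of vertices: the value on `σ` of the image of `c`
is the flat section that extends the value of `c` on the corresponding face of `σ`. -/
noncomputable def cochainsMap (Q P : Set X) {k l : SimplexCategory} (φ : k ⟶ l) :
    F.cochains Q P k →ₗ[ℂ] F.cochains Q P l where
  toFun c := ⟨fun σ => F.extendFace σ φ (c.1 (σ.face φ)), fun σ hσ =>
    (congrArg (F.extendFace σ φ) (c.2 (σ.face φ) (fun t => hσ (simplexMap φ t)))).trans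
      (map_zero (F.extendFace σ φ))⟩
  map_add' a b := by
    apply Subtype.ext
    funext σ
    exact map_add (F.extendFace σ φ) _ _
  map_smul' c a := by
    apply Subtype.ext
    funext σ
    exact map_smul (F.extendFace σ φ) _ _

theorem cochainsMap_apply_val {Q P : Set X} {k l : SimplexCategory} (φ : k ⟶ l)
    (c : F.cochains Q P k) (σ : SingularSimplex Q l) (t : TopSimplex k) :
    ((F.cochainsMap Q P φ c).1 σ).1 (simplexMap φ t) = (c.1 (σ.face φ)).1 t := by
  have h := (F.extend_eq_iff σ.1 (simplexMap φ) (c.1 (σ.face φ))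
    ((F.cochainsMap Q P φ c).1 σ)).1 rfl
  exact (congrFun (congrArg Subtype.val h) t).symm

theorem cochains_val_heq {Q P : Set X} {k : SimplexCategory} (c : F.cochains Q P k)
    {σ τ : SingularSimplex Q k} (h : σ = τ) {t t' : TopSimplex k} (ht : t = t') :
    (c.1 σ).1 t ≍ (c.1 τ).1 t' := by
  subst h
  subst ht
  rfl

theorem cochainsMap_id (Q P : Set X) (k : SimplexCategory) (c : F.cochains Q P k) :
    F.cochainsMap Q P (𝟙 k) c = c := by
  apply Subtype.ext
  funext σ
  obtain ⟨t⟩ : Nonempty (TopSimplex k) := inferInstance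
  refine F.flatSections_ext _ t _ _ (eq_of_heq ?_)
  have ht : simplexMap (𝟙 k) t = t := by rw [simplexMap_id]; rfl
  refine (F.cochains_val_heq _ rfl ht.symm).trans ?_
  refine (heq_of_eq (F.cochainsMap_apply_val (𝟙 k) c σ t)).trans ?_
  refine F.cochains_val_heq c (Subtype.ext ?_) rfl
  change σ.1.comp (simplexMap (𝟙 k)) = σ.1
  rw [simplexMap_id, ContinuousMap.comp_id]

theorem cochainsMap_comp (Q P : Set X) {k l m : SimplexCategory} (φ : k ⟶ l) (ψ : l ⟶ m)
    (c : F.cochains Q P k) :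
    F.cochainsMap Q P (φ ≫ ψ) c = F.cochainsMap Q P ψ (F.cochainsMap Q P φ c) := by
  apply Subtype.ext
  funext σ
  obtain ⟨t⟩ : Nonempty (TopSimplex k) := inferInstance
  refine F.flatSections_ext _ (simplexMap (φ ≫ ψ) t) _ _ (eq_of_heq ?_)
  have ht : simplexMap (φ ≫ ψ) t = simplexMap ψ (simplexMap φ t) := by rw [simplexMap_comp]; rfl
  have e1 := F.cochainsMap_apply_val (φ ≫ ψ) c σ t
  have e2 := F.cochainsMap_apply_val ψ (F.cochainsMap Q P φ c) σ (simplexMap φ t)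
  have e3 := F.cochainsMap_apply_val φ c (σ.face ψ) t
  refine (heq_of_eq e1).trans ?_
  refine HEq.trans ?_ (F.cochains_val_heq (F.cochainsMap Q P ψ (F.cochainsMap Q P φ c))
    (rfl : σ = σ) ht.symm)
  refine HEq.trans ?_ (heq_of_eq (e2.trans e3).symm)
  refine F.cochains_val_heq c (Subtype.ext ?_) rfl
  change σ.1.comp (simplexMap (φ ≫ ψ)) = (σ.1.comp (simplexMap ψ)).comp (simplexMap φ)
  rw [simplexMap_comp, ContinuousMap.comp_assoc]

/-- The cosimplicial vector space of singular cochains of a pair with coefficients in `F`. -/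
noncomputable def cosimplicialCochains (Q P : Set X) : CosimplicialObject (ModuleCat.{u} ℂ) where
  obj k := ModuleCat.of ℂ (F.cochains Q P k)
  map φ := ModuleCat.ofHom (F.cochainsMap Q P φ)
  map_id k := ModuleCat.hom_ext (LinearMap.ext fun c => F.cochainsMap_id Q P k c)
  map_comp φ ψ := ModuleCat.hom_ext (LinearMap.ext fun c => F.cochainsMap_comp Q P φ ψ c)

/-- The singular cochain complex of the pair `(Q, P)` with coefficients in `F`, with the
differential `(dc)(σ) = ∑ (-1)^i c(σ ∘ δ_i)`. -/
noncomputable def cochainComplex (Q P : Set X) : CochainComplex (ModuleCat.{u} ℂ) ℕ :=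
  (AlgebraicTopology.alternatingCofaceMapComplex (ModuleCat.{u} ℂ)).obj (F.cosimplicialCochains Q P)

/-- The inclusion of the cochains of `(R, Q)` in those of `(R, P)`, for `P ⊆ Q`. -/
noncomputable def cochainsIncl (R : Set X) {P Q : Set X} (h : P ⊆ Q) (k : SimplexCategory) :
    F.cochains R Q k →ₗ[ℂ] F.cochains R P k where
  toFun c := ⟨c.1, fun σ hσ => c.2 σ fun t => h (hσ t)⟩
  map_add' _ _ := rfl
  map_smul' _ _ := rfl

/-- The restriction of the cochains of `(R, P)` to `(Q, P)`, for `Q ⊆ R`. -/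
noncomputable def cochainsRestr {Q R : Set X} (h : Q ⊆ R) (P : Set X) (k : SimplexCategory) :
    F.cochains R P k →ₗ[ℂ] F.cochains Q P k where
  toFun c := ⟨fun σ => c.1 ⟨σ.1, fun t => h (σ.2 t)⟩, fun _ hσ => c.2 _ hσ⟩
  map_add' _ _ := rfl
  map_smul' _ _ := rfl

/-- The inclusion of the cochain complex of `(R, Q)` in that of `(R, P)`, for `P ⊆ Q`. -/
noncomputable def complexIncl (R : Set X) {P Q : Set X} (h : P ⊆ Q) :
    F.cochainComplex R Q ⟶ F.cochainComplex R P :=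
  (AlgebraicTopology.alternatingCofaceMapComplex (ModuleCat.{u} ℂ)).map
    { app := fun k => ModuleCat.ofHom (F.cochainsIncl R h k)
      naturality := fun _ _ _ => rfl }

/-- The restriction of the cochain complex of `(R, P)` to that of `(Q, P)`, for `Q ⊆ R`. -/
noncomputable def complexRestr {Q R : Set X} (h : Q ⊆ R) (P : Set X) :
    F.cochainComplex R P ⟶ F.cochainComplex Q P :=
  (AlgebraicTopology.alternatingCofaceMapComplex (ModuleCat.{u} ℂ)).map
    { app := fun k => ModuleCat.ofHom (F.cochainsRestr h P k)
      naturality := fun _ _ _ => rfl }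

/-- The short exact sequence of cochain complexes of a triple `P ⊆ Q ⊆ R`,
`0 → C(R, Q; F) → C(R, P; F) → C(Q, P; F) → 0`. -/
noncomputable def tripleSequence {P Q R : Set X} (hPQ : P ⊆ Q) (hQR : Q ⊆ R) :
    ShortComplex (CochainComplex (ModuleCat.{u} ℂ) ℕ) where
  X₁ := F.cochainComplex R Q
  X₂ := F.cochainComplex R P
  X₃ := F.cochainComplex Q P
  f := F.complexIncl R hPQ
  g := F.complexRestr hQR P
  zero := by
    ext k : 2
    refine LinearMap.ext fun c => Subtype.ext (funext fun σ => ?_)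
    exact c.2 ⟨σ.1, fun t => hQR (σ.2 t)⟩ σ.2

theorem tripleSequence_shortExact {P Q R : Set X} (hPQ : P ⊆ Q) (hQR : Q ⊆ R) :
    (F.tripleSequence hPQ hQR).ShortExact := by
  classical
  rw [HomologicalComplex.shortExact_iff_degreewise_shortExact]
  intro k
  have hinj : Function.Injective (F.cochainsIncl R hPQ (SimplexCategory.mk k)) := by
    intro a b h
    have h' := congrArg Subtype.val h
    exact Subtype.ext h'
  have hsurj : Function.Surjective (F.cochainsRestr hQR P (SimplexCategory.mk k)) := by
    intro c
    refine ⟨⟨fun σ => if h : ∀ t, σ.1 t ∈ Q then c.1 ⟨σ.1, h⟩ else 0, ?_⟩, ?_⟩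
    · intro σ hσ
      have h : ∀ t, σ.1 t ∈ Q := fun t => hPQ (hσ t)
      simp only [h, implies_true, dite_true]
      exact c.2 ⟨σ.1, h⟩ hσ
    · apply Subtype.ext
      funext σ
      exact dif_pos σ.2
  have hexact : Function.Exact (F.cochainsIncl R hPQ (SimplexCategory.mk k))
      (F.cochainsRestr hQR P (SimplexCategory.mk k)) := by
    intro c
    constructor
    · intro h
      refine ⟨⟨c.1, fun σ hσ => ?_⟩, rfl⟩
      exact congrFun (congrArg Subtype.val h) ⟨σ.1, hσ⟩
    · rintro ⟨a, rfl⟩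
      apply Subtype.ext
      funext σ
      exact a.2 ⟨σ.1, fun t => hQR (σ.2 t)⟩ σ.2
  exact ModuleCat.shortComplex_shortExact _ hexact hinj hsurj

/-- The cohomology `H^i(Q, P; F)` of the pair `(Q, P)` of subspaces of `X`, with coefficients in
`F`. The absolute cohomology `H^i(Q; F)` is the case `P = ∅`. -/
noncomputable abbrev cohomology (Q P : Set X) (i : ℕ) : ModuleCat.{u} ℂ :=
  (F.cochainComplex Q P).homology i

end Cohomology

end FlatVectorBundle

section Determinant

universe u

/-- The determinant line `det W = Λ^{dim W} W` (for `s = false`), respectively its inverse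
`(det W)⁻¹ = (det W)^*` (for `s = true`), of a finite-dimensional complex vector space `W`. -/
def DetLine (W : Type u) [AddCommGroup W] [Module ℂ W] : Bool → Type u
  | false => ⋀[ℂ]^(Module.finrank ℂ W) W
  | true => Module.Dual ℂ (⋀[ℂ]^(Module.finrank ℂ W) W)

noncomputable instance (W : Type u) [AddCommGroup W] [Module ℂ W] (s : Bool) :
    AddCommGroup (DetLine W s) :=
  match s with
  | false => inferInstanceAs (AddCommGroup (⋀[ℂ]^(Module.finrank ℂ W) W))
  | true => inferInstanceAs (AddCommGroup (Module.Dual ℂ (⋀[ℂ]^(Module.finrank ℂ W) W)))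

noncomputable instance (W : Type u) [AddCommGroup W] [Module ℂ W] (s : Bool) :
    Module ℂ (DetLine W s) :=
  match s with
  | false => inferInstanceAs (Module ℂ (⋀[ℂ]^(Module.finrank ℂ W) W))
  | true => inferInstanceAs (Module ℂ (Module.Dual ℂ (⋀[ℂ]^(Module.finrank ℂ W) W)))

section Volume

variable {W : Type u} [AddCommGroup W] [Module ℂ W] {m : ℕ}

/-- A basis of `W` with `m` elements, as a basis indexed by `Fin (dim W)`. -/
noncomputable def basisFinrank (b : Module.Basis (Fin m) ℂ W) :
    Module.Basis (Fin (Module.finrank ℂ W)) ℂ W :=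
  b.reindex (finCongr ((Module.finrank_eq_card_basis b).trans (Fintype.card_fin m)).symm)

/-- The element `b_1 ∧ ⋯ ∧ b_m` of `det W`. -/
noncomputable def wedge (b : Module.Basis (Fin m) ℂ W) : ⋀[ℂ]^(Module.finrank ℂ W) W :=
  exteriorPower.ιMulti ℂ (Module.finrank ℂ W) (basisFinrank b)

/-- The element `(b_1 ∧ ⋯ ∧ b_m)⁻¹` of `(det W)^*`: the linear form on `det W` given by the
determinant in the basis `b`, which takes the value `1` on `b_1 ∧ ⋯ ∧ b_m`. -/
noncomputable def wedgeInv (b : Module.Basis (Fin m) ℂ W) :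
    Module.Dual ℂ (⋀[ℂ]^(Module.finrank ℂ W) W) :=
  exteriorPower.alternatingMapLinearEquiv (basisFinrank b).det

theorem wedgeInv_wedge (b : Module.Basis (Fin m) ℂ W) : wedgeInv b (wedge b) = 1 := by
  rw [wedgeInv, wedge, exteriorPower.alternatingMapLinearEquiv_apply_ιMulti]
  exact (basisFinrank b).det_self

theorem wedgeInv_smul_wedge (b : Module.Basis (Fin m) ℂ W)
    (x : ⋀[ℂ]^(Module.finrank ℂ W) W) : wedgeInv b x • wedge b = x := by
  have h : (wedgeInv b).smulRight (wedge b) = LinearMap.id := by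
    apply exteriorPower.linearMap_ext
    refine Module.Basis.ext_alternating (basisFinrank b) fun v hv => ?_
    let σ : Equiv.Perm (Fin (Module.finrank ℂ W)) :=
      Equiv.ofBijective v (Finite.injective_iff_bijective.1 hv)
    have h1 := (((wedgeInv b).smulRight (wedge b)).compAlternatingMap
      (exteriorPower.ιMulti ℂ (Module.finrank ℂ W))).map_perm (basisFinrank b) σ
    have h2 := (LinearMap.id.compAlternatingMap
      (exteriorPower.ιMulti ℂ (Module.finrank ℂ W) (M := W))).map_perm (basisFinrank b) σ
    refine h1.trans (Eq.trans ?_ h2.symm)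
    congr 1
    change wedgeInv b (wedge b) • wedge b = wedge b
    rw [wedgeInv_wedge, one_smul]
  exact LinearMap.congr_fun h x

/-- The generator of `DetLine W s` defined by a basis `b` of `W`: `b_1 ∧ ⋯ ∧ b_m` or its inverse. -/
noncomputable def vol (b : Module.Basis (Fin m) ℂ W) : (s : Bool) → DetLine W s
  | false => wedge b
  | true => wedgeInv b

/-- The coordinate with respect to the generator `vol b s` of the line `DetLine W s`. -/
noncomputable def volCoord (b : Module.Basis (Fin m) ℂ W) : (s : Bool) → DetLine W s →ₗ[ℂ] ℂ
  | false => wedgeInv b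
  | true => Module.Dual.eval ℂ (⋀[ℂ]^(Module.finrank ℂ W) W) (wedge b)

theorem volCoord_vol (b : Module.Basis (Fin m) ℂ W) (s : Bool) : volCoord b s (vol b s) = 1 := by
  cases s
  · exact wedgeInv_wedge b
  · exact wedgeInv_wedge b

theorem volCoord_smul_vol (b : Module.Basis (Fin m) ℂ W) (s : Bool) (x : DetLine W s) :
    volCoord b s x • vol b s = x := by
  cases s
  · exact wedgeInv_smul_wedge b x
  · refine LinearMap.ext fun y => ?_
    change Module.Dual ℂ (⋀[ℂ]^(Module.finrank ℂ W) W) at x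
    have h := congrArg x (wedgeInv_smul_wedge b y)
    rw [map_smul, smul_eq_mul, mul_comm] at h
    exact h

end Volume

/-- The determinant line `det E = ⨂_{i = 0}^n (det E^i)^{(-1)^i}` of a graded vector space `E`
that is concentrated in the degrees `0, …, n`. -/
abbrev GradedDet (n : ℕ) (E : ℕ → ModuleCat.{u} ℂ) : Type u :=
  ⨂[ℂ] i : Fin (n + 1), DetLine (E i) (i : ℕ).bodd

section GradedVolume

variable {E : ℕ → ModuleCat.{u} ℂ} {m : ℕ → ℕ} (n : ℕ)

/-- The generator of `det E` defined by a basis of `E^i` for each `i`. -/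
noncomputable def gradedVol (b : ∀ i, Module.Basis (Fin (m i)) ℂ (E i)) : GradedDet n E :=
  PiTensorProduct.tprod ℂ fun i : Fin (n + 1) => vol (b i) (i : ℕ).bodd

/-- The coordinate with respect to the generator `gradedVol n b` of the line `det E`. -/
noncomputable def gradedVolCoord (b : ∀ i, Module.Basis (Fin (m i)) ℂ (E i)) :
    GradedDet n E →ₗ[ℂ] ℂ :=
  PiTensorProduct.lift ((MultilinearMap.mkPiAlgebra ℂ (Fin (n + 1)) ℂ).compLinearMap
    fun i => volCoord (b i) (i : ℕ).bodd)

theorem gradedVolCoord_gradedVol (b : ∀ i, Module.Basis (Fin (m i)) ℂ (E i)) :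
    gradedVolCoord n b (gradedVol n b) = 1 := by
  rw [gradedVolCoord, gradedVol, PiTensorProduct.lift.tprod]
  simp [volCoord_vol]

theorem gradedVolCoord_smul_gradedVol (b : ∀ i, Module.Basis (Fin (m i)) ℂ (E i))
    (x : GradedDet n E) : gradedVolCoord n b x • gradedVol n b = x := by
  have h : (gradedVolCoord n b).smulRight (gradedVol n b) = LinearMap.id := by
    apply PiTensorProduct.ext
    ext v
    have e : v = fun i : Fin (n + 1) => volCoord (b i) (i : ℕ).bodd (v i) • vol (b i) (i : ℕ).bodd :=
      funext fun i => (volCoord_smul_vol (b i) _ (v i)).symm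
    conv_rhs => rw [e]
    simp only [LinearMap.compMultilinearMap_apply, LinearMap.id_apply, LinearMap.smulRight_apply]
    rw [MultilinearMap.map_smul_univ, gradedVolCoord, PiTensorProduct.lift.tprod, gradedVol]
    simp
  exact LinearMap.congr_fun h x

end GradedVolume

/-- A long exact sequence
`0 → A^0 → B^0 → C^0 → A^1 → B^1 → C^1 → A^2 → ⋯` of complex vector spaces. -/
structure LongExactSequence where
  A : ℕ → ModuleCat.{u} ℂ
  B : ℕ → ModuleCat.{u} ℂ
  C : ℕ → ModuleCat.{u} ℂ
  a : ∀ i, A i →ₗ[ℂ] B i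
  b : ∀ i, B i →ₗ[ℂ] C i
  δ : ∀ i, C i →ₗ[ℂ] A (i + 1)
  injective_a : Function.Injective (a 0)
  exact_a_b : ∀ i, Function.Exact (a i) (b i)
  exact_b_δ : ∀ i, Function.Exact (b i) (δ i)
  exact_δ_a : ∀ i, Function.Exact (δ i) (a (i + 1))

namespace LongExactSequence

variable (L : LongExactSequence.{u})

/-- All terms of the long exact sequence are finite-dimensional, and those of degree `> n`
vanish. -/
structure IsFinite (n : ℕ) : Prop where
  finA : ∀ i, FiniteDimensional ℂ (L.A i)
  finB : ∀ i, FiniteDimensional ℂ (L.B i)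
  finC : ∀ i, FiniteDimensional ℂ (L.C i)
  zeroA : ∀ i, n < i → Subsingleton (L.A i)
  zeroB : ∀ i, n < i → Subsingleton (L.B i)
  zeroC : ∀ i, n < i → Subsingleton (L.C i)

/-- The rank of the connecting map that ends in degree `i`, where `r i` is the rank of the one that
starts in degree `i`. -/
def prev (r : ℕ → ℕ) : ℕ → ℕ
  | 0 => 0
  | i + 1 => r i

/-- Bases of the terms of a long exact sequence that are adapted to its maps: in each term, the
last vectors of the basis project to a basis of the cokernel of the incoming map, and the first
ones are the images under the incoming map of the last basis vectors of the preceding term. -/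
structure AdaptedBases where
  p : ℕ → ℕ
  q : ℕ → ℕ
  r : ℕ → ℕ
  basisA : ∀ i, Module.Basis (Fin (prev r i + p i)) ℂ (L.A i)
  basisB : ∀ i, Module.Basis (Fin (p i + q i)) ℂ (L.B i)
  basisC : ∀ i, Module.Basis (Fin (q i + r i)) ℂ (L.C i)
  map_a : ∀ i (j : Fin (p i)),
    basisB i (Fin.castAdd (q i) j) = L.a i (basisA i (Fin.natAdd (prev r i) j))
  map_b : ∀ i (j : Fin (q i)),
    basisC i (Fin.castAdd (r i) j) = L.b i (basisB i (Fin.natAdd (p i) j))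
  map_δ : ∀ i (j : Fin (r i)),
    basisA (i + 1) (Fin.castAdd (p (i + 1)) j) = L.δ i (basisC i (Fin.natAdd (q i) j))

/-- The isomorphism of lines `det C ⊗ det A ≅ det B` defined by adapted bases of a long exact
sequence: it maps the tensor product of the generators defined by the bases to the generator
defined by the bases. In other words, it is the isomorphism defined by the canonical element
`⨂_i (∧ basis of A^i)^{(-1)^i} ⊗ (∧ basis of B^i)^{-(-1)^i} ⊗ (∧ basis of C^i)^{(-1)^i}`
of the determinant line of the long exact sequence, viewed as an acyclic complex. -/
noncomputable def AdaptedBases.detIso {L : LongExactSequence.{u}} (D : L.AdaptedBases) (n : ℕ) :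
    GradedDet n L.C ⊗[ℂ] GradedDet n L.A ≃ₗ[ℂ] GradedDet n L.B where
  toFun x := LinearMap.mul' ℂ ℂ (TensorProduct.map (gradedVolCoord n D.basisC)
    (gradedVolCoord n D.basisA) x) • gradedVol n D.basisB
  map_add' x y := by rw [map_add, map_add, add_smul]
  map_smul' c x := by rw [map_smul, map_smul, smul_assoc, RingHom.id_apply]
  invFun y := gradedVolCoord n D.basisB y •
    (gradedVol n D.basisC ⊗ₜ[ℂ] gradedVol n D.basisA)
  left_inv x := by
    dsimp only
    rw [map_smul, gradedVolCoord_gradedVol, smul_eq_mul, mul_one]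
    induction x with
    | zero => rw [map_zero, map_zero, zero_smul]
    | add x y hx hy => rw [map_add, map_add, add_smul, hx, hy]
    | tmul x y =>
      conv_rhs => rw [← gradedVolCoord_smul_gradedVol n D.basisC x,
        ← gradedVolCoord_smul_gradedVol n D.basisA y]
      rw [TensorProduct.map_tmul, LinearMap.mul'_apply, TensorProduct.smul_tmul_smul]
  right_inv y := by
    dsimp only
    rw [map_smul, map_smul, TensorProduct.map_tmul, LinearMap.mul'_apply,
      gradedVolCoord_gradedVol, gradedVolCoord_gradedVol, mul_one, smul_eq_mul, mul_one,
      gradedVolCoord_smul_gradedVol]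

theorem AdaptedBases.detIso_gradedVol {L : LongExactSequence.{u}} (D : L.AdaptedBases) (n : ℕ) :
    D.detIso n (gradedVol n D.basisC ⊗ₜ[ℂ] gradedVol n D.basisA) = gradedVol n D.basisB := by
  change LinearMap.mul' ℂ ℂ (TensorProduct.map (gradedVolCoord n D.basisC)
    (gradedVolCoord n D.basisA) _) • gradedVol n D.basisB = _
  rw [TensorProduct.map_tmul, LinearMap.mul'_apply, gradedVolCoord_gradedVol,
    gradedVolCoord_gradedVol, mul_one, one_smul]

theorem exists_lift_basis_range {V W : Type u} [AddCommGroup V] [Module ℂ V] [AddCommGroup W]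
    [Module ℂ W] [FiniteDimensional ℂ V] (f : V →ₗ[ℂ] W) :
    ∃ v : Fin (Module.finrank ℂ (LinearMap.range f)) → V,
      LinearIndependent ℂ (f ∘ v) ∧ Submodule.span ℂ (range (f ∘ v)) = LinearMap.range f := by
  let e := Module.finBasis ℂ (LinearMap.range f)
  choose v hv using fun i => (e i).2
  have h : f ∘ v = (LinearMap.range f).subtype ∘ e := funext hv
  refine ⟨v, ?_, ?_⟩
  · rw [h]
    exact e.linearIndependent.map' _ (Submodule.ker_subtype _)
  · rw [h, range_comp, ← Submodule.map_span, e.span_eq, Submodule.map_subtype_top]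

theorem exists_basis_append {V W : Type u} [AddCommGroup V] [Module ℂ V] [AddCommGroup W]
    [Module ℂ W] (f : V →ₗ[ℂ] W) {k l : ℕ} (u : Fin k → V) (v : Fin l → V)
    (hu : LinearIndependent ℂ u) (hu' : Submodule.span ℂ (range u) = LinearMap.ker f)
    (hv : LinearIndependent ℂ (f ∘ v))
    (hv' : Submodule.span ℂ (range (f ∘ v)) = LinearMap.range f) :
    ∃ b : Module.Basis (Fin (k + l)) ℂ V,
      (∀ j, b (Fin.castAdd l j) = u j) ∧ ∀ j, b (Fin.natAdd k j) = v j := by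
  have hdisj : Disjoint (Submodule.span ℂ (range u)) (Submodule.span ℂ (range v)) := by
    rw [hu', disjoint_comm]
    exact Submodule.range_ker_disjoint hv
  have hli : LinearIndependent ℂ (Sum.elim u v) := (hu.sum_type (hv.of_comp f) hdisj)
  have hsp : ⊤ ≤ Submodule.span ℂ (range (Sum.elim u v)) := by
    intro x _
    rw [Sum.elim_range, Submodule.span_union, hu']
    have hx : f x ∈ Submodule.map f (Submodule.span ℂ (range v)) := by
      rw [Submodule.map_span, ← range_comp, hv']
      exact ⟨x, rfl⟩
    obtain ⟨y, hy, hyx⟩ := hx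
    refine Submodule.mem_sup.2 ⟨x - y, ?_, y, hy, sub_add_cancel x y⟩
    rw [LinearMap.mem_ker, map_sub, hyx, sub_self]
  refine ⟨(Module.Basis.mk hli hsp).reindex finSumFinEquiv, fun j => ?_, fun j => ?_⟩
  · simp
  · simp

theorem nonempty_adaptedBases {L : LongExactSequence.{u}} {n : ℕ} (h : L.IsFinite n) :
    Nonempty L.AdaptedBases := by
  have := h.finA
  have := h.finB
  have := h.finC
  choose va hva hva' using fun i => exists_lift_basis_range (L.a i)
  choose vb hvb hvb' using fun i => exists_lift_basis_range (L.b i)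
  choose vc hvc hvc' using fun i => exists_lift_basis_range (L.δ i)
  let p : ℕ → ℕ := fun i => Module.finrank ℂ (LinearMap.range (L.a i))
  let q : ℕ → ℕ := fun i => Module.finrank ℂ (LinearMap.range (L.b i))
  let r : ℕ → ℕ := fun i => Module.finrank ℂ (LinearMap.range (L.δ i))
  have hA0 : ∃ b : Module.Basis (Fin (0 + p 0)) ℂ (L.A 0), ∀ j, b (Fin.natAdd 0 j) = va 0 j := by
    obtain ⟨b, -, hb⟩ := exists_basis_append (L.a 0) (Fin.elim0 : Fin 0 → L.A 0) (va 0)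
      linearIndependent_empty_type
      (by rw [range_eq_empty, Submodule.span_empty, LinearMap.ker_eq_bot.2 L.injective_a])
      (hva 0) (hva' 0)
    exact ⟨b, hb⟩
  obtain ⟨bA0, hbA0⟩ := hA0
  choose bA hbA hbA' using fun i => exists_basis_append (L.a (i + 1)) (L.δ i ∘ vc i) (va (i + 1))
    (hvc i) ((hvc' i).trans (L.exact_δ_a i).linearMap_ker_eq.symm) (hva (i + 1)) (hva' (i + 1))
  choose bB hbB hbB' using fun i => exists_basis_append (L.b i) (L.a i ∘ va i) (vb i)
    (hva i) ((hva' i).trans (L.exact_a_b i).linearMap_ker_eq.symm) (hvb i) (hvb' i)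
  choose bC hbC hbC' using fun i => exists_basis_append (L.δ i) (L.b i ∘ vb i) (vc i)
    (hvb i) ((hvb' i).trans (L.exact_b_δ i).linearMap_ker_eq.symm) (hvc i) (hvc' i)
  let basA : ∀ i, Module.Basis (Fin (prev r i + p i)) ℂ (L.A i) := fun i =>
    match i with
    | 0 => bA0
    | i + 1 => bA i
  have hbasA : ∀ i j, basA i (Fin.natAdd (prev r i) j) = va i j := by
    intro i j
    cases i with
    | zero => exact hbA0 j
    | succ i => exact hbA' i j
  exact ⟨{
    p := p
    q := q
    r := r
    basisA := basA
    basisB := bB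
    basisC := bC
    map_a := fun i j => (hbB i j).trans (congrArg (L.a i) (hbasA i j)).symm
    map_b := fun i j => (hbC i j).trans (congrArg (L.b i) (hbB' i j)).symm
    map_δ := fun i j => (hbA i j).trans (congrArg (L.δ i) (hbC' i j)).symm }⟩

open Classical in
/-- The canonical isomorphism of lines `det C ⊗ det A ≅ det B` associated with a long exact sequence
of finite-dimensional vector spaces that vanish in degrees `> n`, computed with any adapted bases.
(Like every function it is total: it is set to `0` if one of the vector spaces is
infinite-dimensional or does not vanish in some degree `> n`.) -/
noncomputable def detMap (n : ℕ) :
    GradedDet n L.C ⊗[ℂ] GradedDet n L.A →ₗ[ℂ] GradedDet n L.B :=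
  if h : L.IsFinite n then ((nonempty_adaptedBases h).some.detIso n).toLinearMap else 0

theorem detMap_bijective {n : ℕ} (h : L.IsFinite n) : Function.Bijective (L.detMap n) := by
  rw [detMap, dif_pos h]
  exact ((nonempty_adaptedBases h).some.detIso n).bijective

end LongExactSequence

end Determinant

namespace FlatVectorBundle

universe u

variable {X : Type u} [TopologicalSpace X] {r : ℕ} {ι : Type*} (F : FlatVectorBundle X r ι)

/-- The long exact cohomology sequence of a triple `P ⊆ Q ⊆ R`,
`⋯ → H^i(R, Q; F) → H^i(R, P; F) → H^i(Q, P; F) → H^{i+1}(R, Q; F) → ⋯`. -/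
noncomputable def longExactSequence {P Q R : Set X} (hPQ : P ⊆ Q) (hQR : Q ⊆ R) :
    LongExactSequence.{u} where
  A := F.cohomology R Q
  B := F.cohomology R P
  C := F.cohomology Q P
  a i := (HomologicalComplex.homologyMap (F.complexIncl R hPQ) i).hom
  b i := (HomologicalComplex.homologyMap (F.complexRestr hQR P) i).hom
  δ i := ((F.tripleSequence_shortExact hPQ hQR).δ i (i + 1) rfl).hom
  injective_a := by
    have := (F.tripleSequence_shortExact hPQ hQR).mono_f
    have : Mono (F.complexIncl R hPQ) := this
    have : Mono (HomologicalComplex.homologyMap (F.complexIncl R hPQ) 0) :=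
      HomologicalComplex.mono_homologyMap_of_mono_of_not_rel _ 0 (by simp)
    exact (ModuleCat.mono_iff_injective _).1 this
  exact_a_b i := (ShortComplex.ShortExact.moduleCat_exact_iff_function_exact _).1
    ((F.tripleSequence_shortExact hPQ hQR).homology_exact₂ i)
  exact_b_δ i := (ShortComplex.ShortExact.moduleCat_exact_iff_function_exact _).1
    ((F.tripleSequence_shortExact hPQ hQR).homology_exact₃ i (i + 1) rfl)
  exact_δ_a i := (ShortComplex.ShortExact.moduleCat_exact_iff_function_exact _).1
    ((F.tripleSequence_shortExact hPQ hQR).homology_exact₁ i (i + 1) rfl)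

/-- The canonical isomorphism `det H(Q, P; F) ⊗ det H(R, Q; F) ≅ det H(R, P; F)` given by the
long exact cohomology sequence of a triple `P ⊆ Q ⊆ R`, the cohomology being concentrated in
degrees `0, …, n`. -/
noncomputable def fusion (n : ℕ) {P Q R : Set X} (hPQ : P ⊆ Q) (hQR : Q ⊆ R) :
    GradedDet n (F.cohomology Q P) ⊗[ℂ] GradedDet n (F.cohomology R Q) →ₗ[ℂ]
      GradedDet n (F.cohomology R P) :=
  (F.longExactSequence hPQ hQR).detMap n

end FlatVectorBundle

-- The argument is linear algebra on the filtration `∅ ⊆ Y₁ ⊆ Y₂ ⊆ Y₃`. Its four triples have long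
-- exact sequences that interlock in a commutative braid on the six graded spaces `H(Y_k, Y_j)`. If
-- one basis of each of the six spaces can be chosen so that all four sequences are adapted to these
-- bases at once, then each of the four isomorphisms sends generator to generator up to a phase.
-- Both composites then send the same generator of a line to unimodular multiples of the same
-- vector, which is the claim.
--
-- Two facts carry this. The first, `SplitBases.detMap_gradedVol`, says that the isomorphism of a
-- long exact sequence may be computed, up to modulus one, with any adapted bases and not only with
-- those chosen in `detMap`. Two adapted systems differ by an automorphism of the sequence.
-- Exactness factors its determinants through the images of the maps, and the alternating product
-- telescopes to 1 (`exists_det_factors`, `prod_norm_det`). Orderings of the bases contribute only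
-- signs, which the norm does not see.
--
-- The second, `nonempty_families` with `Families.nonempty_bases`, provides the simultaneous bases.
-- Over a field the braid splits into six kinds of elementary braids, one for the image of each of
-- the maps `a → d`, `b → e`, `d → f`, `c → a[1]`, `e → b[1]`, `f → c[1]`. Lifting a basis of each
-- image and pushing it along the braid gives bases of all six terms, since each term is filtered by
-- kernels and images whose graded pieces are among these images.
--
-- If the finiteness required by `detMap` fails, both composites are zero.

universe u

/-! ### Generators of determinant lines under change of basis, up to phase -/

section Volume

variable {W : Type u} [AddCommGroup W] [Module ℂ W]

/-- The two enumerations differ from the matching `e` by a permutation, whose sign disappears in the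
norm. -/
theorem norm_det_reindex {κ κ' : Type*} [Fintype κ] [Fintype κ'] {N : ℕ}
    (b : Module.Basis κ ℂ W) (b' : Module.Basis κ' ℂ W) (e : κ ≃ κ') (u : κ ≃ Fin N)
    (u' : κ' ≃ Fin N) :
    ‖(b.reindex u).det (b'.reindex u')‖ = ‖LinearMap.det (b.equiv b' e : W →ₗ[ℂ] W)‖ := by
  have h : ⇑(b'.reindex u') = ((b.equiv b' e : W →ₗ[ℂ] W) ∘ (b.reindex u)) ∘
      ((u'.symm.trans e.symm).trans u) := by
    funext j
    simp [Module.Basis.equiv_apply]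
  rw [h, AlternatingMap.map_perm, Module.Basis.det_comp, Module.Basis.det_self, mul_one]
  rcases Int.units_eq_one_or (Equiv.Perm.sign ((u'.symm.trans e.symm).trans u)) with hs | hs <;>
    rw [hs] <;> simp

/-- A basis with an arbitrary finite index type, reindexed by an initial segment of `ℕ`. -/
noncomputable def Module.Basis.enum {κ : Type*} [Fintype κ] (b : Module.Basis κ ℂ W) :
    Module.Basis (Fin (Fintype.card κ)) ℂ W :=
  b.reindex (Fintype.equivFin κ)

theorem exists_basisFinrank_reindex {κ : Type*} (b : Module.Basis κ ℂ W) {m : ℕ} (u : κ ≃ Fin m) :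
    ∃ v, basisFinrank (b.reindex u) = b.reindex v := by
  refine ⟨u.trans (finCongr ((Module.finrank_eq_card_basis (b.reindex u)).trans
    (Fintype.card_fin m)).symm), ?_⟩
  ext j
  simp [basisFinrank]

theorem norm_volCoord_vol {κ κ' : Type*} [Fintype κ] [Fintype κ']
    (b : Module.Basis κ ℂ W) (b' : Module.Basis κ' ℂ W) (e : κ ≃ κ') (s : Bool) {m m' : ℕ}
    (u : κ ≃ Fin m) (u' : κ' ≃ Fin m') :
    ‖volCoord (b.reindex u) s (vol (b'.reindex u') s)‖ =
      bif s then ‖LinearMap.det (b.equiv b' e : W →ₗ[ℂ] W)‖⁻¹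
      else ‖LinearMap.det (b.equiv b' e : W →ₗ[ℂ] W)‖ := by
  cases s
  · change ‖wedgeInv (b.reindex u) (wedge (b'.reindex u'))‖ = _
    rw [wedgeInv, wedge, exteriorPower.alternatingMapLinearEquiv_apply_ιMulti]
    obtain ⟨v, hv⟩ := exists_basisFinrank_reindex b u
    obtain ⟨v', hv'⟩ := exists_basisFinrank_reindex b' u'
    rw [hv, hv', norm_det_reindex b b' e]
    rfl
  -- On the dual line the coordinate is evaluation at the wedge of `b`, so the two bases exchange
  -- roles and the determinant is that of the inverse automorphism.
  · change ‖wedgeInv (b'.reindex u') (wedge (b.reindex u))‖ = _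
    rw [wedgeInv, wedge, exteriorPower.alternatingMapLinearEquiv_apply_ιMulti]
    obtain ⟨v, hv⟩ := exists_basisFinrank_reindex b u
    obtain ⟨v', hv'⟩ := exists_basisFinrank_reindex b' u'
    rw [hv, hv', norm_det_reindex b' b e.symm]
    have h : (b'.equiv b e.symm) = (b.equiv b' e).symm := by
      rw [Module.Basis.equiv_symm]
    rw [h, LinearEquiv.det_coe_symm, norm_inv]
    rfl

theorem norm_gradedVolCoord_gradedVol {E : ℕ → ModuleCat.{u} ℂ} {κ κ' : ℕ → Type*}
    [∀ i, Fintype (κ i)] [∀ i, Fintype (κ' i)] (n : ℕ) (b : ∀ i, Module.Basis (κ i) ℂ (E i))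
    (b' : ∀ i, Module.Basis (κ' i) ℂ (E i)) (e : ∀ i, κ i ≃ κ' i) {m m' : ℕ → ℕ}
    (u : ∀ i, κ i ≃ Fin (m i)) (u' : ∀ i, κ' i ≃ Fin (m' i)) :
    ‖gradedVolCoord n (fun i => (b i).reindex (u i)) (gradedVol n fun i => (b' i).reindex (u' i))‖ =
      ∏ i ∈ Finset.range (n + 1),
        bif i.bodd then ‖LinearMap.det ((b i).equiv (b' i) (e i) : E i →ₗ[ℂ] E i)‖⁻¹
        else ‖LinearMap.det ((b i).equiv (b' i) (e i) : E i →ₗ[ℂ] E i)‖ := by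
  rw [gradedVolCoord, gradedVol, PiTensorProduct.lift.tprod, Finset.prod_range]
  simp [norm_prod, norm_volCoord_vol _ _ (e _)]

/-- The automorphism matching a basis with its own reindexing is the identity, so every factor of
the product is 1. -/
theorem norm_gradedVolCoord_reindex {E : ℕ → ModuleCat.{u} ℂ} {κ κ' : ℕ → Type*}
    [∀ i, Fintype (κ i)] [∀ i, Fintype (κ' i)] (n : ℕ) (b : ∀ i, Module.Basis (κ i) ℂ (E i))
    (e : ∀ i, κ i ≃ κ' i) :
    ‖gradedVolCoord n (fun i => (b i).enum) (gradedVol n fun i => ((b i).reindex (e i)).enum)‖ =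
      1 := by
  refine (norm_gradedVolCoord_gradedVol n b (fun i => (b i).reindex (e i)) e _ _).trans ?_
  refine Finset.prod_eq_one fun i _ => ?_
  have h : (b i).equiv ((b i).reindex (e i)) (e i) = LinearEquiv.refl ℂ (E i) :=
    (b i).ext' fun j => by simp [Module.Basis.equiv_apply]
  rw [h]
  cases i.bodd <;> simp

end Volume

/-! ### Determinants along an exact pair of maps -/

section Determinants

/-- The determinant is multiplicative along the stable subspace `range f = ker h`, and `h`
identifies the quotient by it with `range h`, carrying the map induced by `g` to the restriction of
`k`. -/
theorem det_eq_det_range_mul_det_range {K U V W : Type*} [Field K] [AddCommGroup U] [Module K U]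
    [AddCommGroup V] [Module K V] [AddCommGroup W] [Module K W] [FiniteDimensional K V]
    {f : U →ₗ[K] V} {h : V →ₗ[K] W} (hfh : Function.Exact f h) (g : V →ₗ[K] V) (k : W →ₗ[K] W)
    (hf : ∀ x ∈ LinearMap.range f, g x ∈ LinearMap.range f)
    (hh : ∀ x ∈ LinearMap.range h, k x ∈ LinearMap.range h) (hgk : ∀ x, h (g x) = k (h x)) :
    LinearMap.det g = LinearMap.det (g.restrict hf) * LinearMap.det (k.restrict hh) := by
  have hker : LinearMap.ker h = LinearMap.range f := hfh.linearMap_ker_eq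
  rw [LinearMap.det_eq_det_mul_det (LinearMap.range f) g hf]
  congr 1
  let e : (V ⧸ LinearMap.range f) ≃ₗ[K] LinearMap.range h :=
    (Submodule.quotEquivOfEq _ _ hker.symm).trans h.quotKerEquivRange
  rw [← LinearMap.det_conj _ e]
  congr 1
  ext x
  obtain ⟨x, y, rfl⟩ := x
  have he : ∀ y, e (Submodule.Quotient.mk y) = ⟨h y, y, rfl⟩ := fun y => rfl
  have : e.symm ⟨h y, y, rfl⟩ = Submodule.Quotient.mk y := by
    rw [LinearEquiv.symm_apply_eq, he]
  simp only [LinearMap.comp_apply, LinearEquiv.coe_coe, this, Submodule.mapQ_apply,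
    LinearMap.restrict_apply, he]
  exact congrArg Subtype.val (he (g y)) |>.trans (hgk y)

end Determinants

/-! ### Independence of the determinant isomorphism from the adapted bases -/

namespace LongExactSequence

variable {L : LongExactSequence.{u}}

/-- Bases adapted to the maps of a long exact sequence, with arbitrary finite index types: `R i`,
`P i` and `Q i` index the vectors of `A i`, `B i` and `C i` that come from the preceding term. -/
structure SplitBases (L : LongExactSequence.{u}) where
  R : ℕ → Type
  P : ℕ → Type
  Q : ℕ → Type
  fintypeR : ∀ i, Fintype (R i)
  fintypeP : ∀ i, Fintype (P i)
  fintypeQ : ∀ i, Fintype (Q i)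
  isEmpty_R : IsEmpty (R 0)
  basisA : ∀ i, Module.Basis (R i ⊕ P i) ℂ (L.A i)
  basisB : ∀ i, Module.Basis (P i ⊕ Q i) ℂ (L.B i)
  basisC : ∀ i, Module.Basis (Q i ⊕ R (i + 1)) ℂ (L.C i)
  map_a : ∀ i j, L.a i (basisA i (.inr j)) = basisB i (.inl j)
  map_b : ∀ i j, L.b i (basisB i (.inr j)) = basisC i (.inl j)
  map_δ : ∀ i j, L.δ i (basisC i (.inr j)) = basisA (i + 1) (.inl j)

attribute [instance] SplitBases.fintypeR SplitBases.fintypeP SplitBases.fintypeQ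

namespace SplitBases

theorem a_inl (S : L.SplitBases) (i : ℕ) (j : S.R i) : L.a i (S.basisA i (.inl j)) = 0 := by
  cases i with
  | zero => exact S.isEmpty_R.elim j
  | succ i => rw [← S.map_δ]; exact (L.exact_δ_a i).apply_apply_eq_zero _

theorem b_inl (S : L.SplitBases) (i : ℕ) (j : S.P i) : L.b i (S.basisB i (.inl j)) = 0 := by
  rw [← S.map_a]; exact (L.exact_a_b i).apply_apply_eq_zero _

theorem δ_inl (S : L.SplitBases) (i : ℕ) (j : S.Q i) : L.δ i (S.basisC i (.inl j)) = 0 := by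
  rw [← S.map_b]; exact (L.exact_b_δ i).apply_apply_eq_zero _

/-- Induction on the degree: `R 0` is empty, and the dimensions of `A i`, `B i`, `C i` determine in
turn the sizes of `P i`, `Q i`, `R (i + 1)`. -/
theorem card_eq (S T : L.SplitBases) (i : ℕ) :
    Fintype.card (S.R i) = Fintype.card (T.R i) ∧ Fintype.card (S.P i) = Fintype.card (T.P i) ∧
      Fintype.card (S.Q i) = Fintype.card (T.Q i) := by
  have h1 := fun i => (Module.finrank_eq_card_basis (S.basisA i)).symm.trans
    (Module.finrank_eq_card_basis (T.basisA i))
  have h2 := fun i => (Module.finrank_eq_card_basis (S.basisB i)).symm.trans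
    (Module.finrank_eq_card_basis (T.basisB i))
  have h3 := fun i => (Module.finrank_eq_card_basis (S.basisC i)).symm.trans
    (Module.finrank_eq_card_basis (T.basisC i))
  simp only [Fintype.card_sum] at h1 h2 h3
  have hR : Fintype.card (S.R i) = Fintype.card (T.R i) := by
    induction i with
    | zero =>
      have := S.isEmpty_R
      have := T.isEmpty_R
      rw [Fintype.card_eq_zero, Fintype.card_eq_zero]
    | succ i ih =>
      have := h1 i
      have := h2 i
      have := h3 i
      omega
  have := h1 i
  have := h2 i
  omega

noncomputable def equivR (S T : L.SplitBases) (i : ℕ) : S.R i ≃ T.R i :=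
  Fintype.equivOfCardEq (S.card_eq T i).1

noncomputable def equivP (S T : L.SplitBases) (i : ℕ) : S.P i ≃ T.P i :=
  Fintype.equivOfCardEq (S.card_eq T i).2.1

noncomputable def equivQ (S T : L.SplitBases) (i : ℕ) : S.Q i ≃ T.Q i :=
  Fintype.equivOfCardEq (S.card_eq T i).2.2

/-- The automorphism of `A i` that maps the first adapted basis to the second one. -/
noncomputable def autA (S T : L.SplitBases) (i : ℕ) : L.A i ≃ₗ[ℂ] L.A i :=
  (S.basisA i).equiv (T.basisA i) (Equiv.sumCongr (S.equivR T i) (S.equivP T i))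

/-- The automorphism of `B i` that maps the first adapted basis to the second one. -/
noncomputable def autB (S T : L.SplitBases) (i : ℕ) : L.B i ≃ₗ[ℂ] L.B i :=
  (S.basisB i).equiv (T.basisB i) (Equiv.sumCongr (S.equivP T i) (S.equivQ T i))

/-- The automorphism of `C i` that maps the first adapted basis to the second one. -/
noncomputable def autC (S T : L.SplitBases) (i : ℕ) : L.C i ≃ₗ[ℂ] L.C i :=
  (S.basisC i).equiv (T.basisC i) (Equiv.sumCongr (S.equivQ T i) (S.equivR T (i + 1)))

variable (S T : L.SplitBases)

/-- With the two lemmas that follow, this makes the three families of automorphisms an automorphism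
of the long exact sequence. It is checked on basis vectors: those coming from the preceding term are
killed, the others go to matching basis vectors of the next term. -/
theorem a_autA (i : ℕ) (x : L.A i) : L.a i (S.autA T i x) = S.autB T i (L.a i x) := by
  have h : L.a i ∘ₗ (S.autA T i).toLinearMap = (S.autB T i).toLinearMap ∘ₗ L.a i := by
    refine (S.basisA i).ext ?_
    rintro (j | j) <;>
      simp [autA, autB, Module.Basis.equiv_apply, a_inl, map_a]
  exact LinearMap.congr_fun h x

theorem b_autB (i : ℕ) (x : L.B i) : L.b i (S.autB T i x) = S.autC T i (L.b i x) := by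
  have h : L.b i ∘ₗ (S.autB T i).toLinearMap = (S.autC T i).toLinearMap ∘ₗ L.b i := by
    refine (S.basisB i).ext ?_
    rintro (j | j) <;>
      simp [autB, autC, Module.Basis.equiv_apply, b_inl, map_b]
  exact LinearMap.congr_fun h x

theorem δ_autC (i : ℕ) (x : L.C i) : L.δ i (S.autC T i x) = S.autA T (i + 1) (L.δ i x) := by
  have h : L.δ i ∘ₗ (S.autC T i).toLinearMap = (S.autA T (i + 1)).toLinearMap ∘ₗ L.δ i := by
    refine (S.basisC i).ext ?_
    rintro (j | j) <;>
      simp [autC, autA, Module.Basis.equiv_apply, δ_inl, map_δ]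
  exact LinearMap.congr_fun h x

/-- The factors `x i`, `y i`, `z i` are the determinants on the images in `A i`, `B i`, `C i` of the
incoming maps. Exactness makes each term an extension of the next image by the present one. -/
theorem exists_det_factors {n : ℕ} (hL : L.IsFinite n) : ∃ x y z : ℕ → ℂ, x 0 = 1 ∧
    x (n + 1) = 1 ∧ ∀ i, LinearMap.det (S.autA T i : L.A i →ₗ[ℂ] L.A i) = x i * y i ∧
      LinearMap.det (S.autB T i : L.B i →ₗ[ℂ] L.B i) = y i * z i ∧
      LinearMap.det (S.autC T i : L.C i →ₗ[ℂ] L.C i) = z i * x (i + 1) := by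
  have := hL.finA
  have := hL.finB
  have := hL.finC
  have ha : ∀ i, ∀ x ∈ LinearMap.range (L.a i), S.autB T i x ∈ LinearMap.range (L.a i) := by
    rintro i _ ⟨x, rfl⟩
    exact ⟨_, S.a_autA T i x⟩
  have hb : ∀ i, ∀ x ∈ LinearMap.range (L.b i), S.autC T i x ∈ LinearMap.range (L.b i) := by
    rintro i _ ⟨x, rfl⟩
    exact ⟨_, S.b_autB T i x⟩
  have hδ : ∀ i, ∀ x ∈ LinearMap.range (L.δ i), S.autA T (i + 1) x ∈ LinearMap.range (L.δ i) := by
    rintro i _ ⟨x, rfl⟩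
    exact ⟨_, S.δ_autC T i x⟩
  -- Nothing comes into `A 0`, so the determinant on the zero image there is set to 1.
  let x : ℕ → ℂ := fun i => match i with
    | 0 => 1
    | i + 1 => LinearMap.det ((S.autA T (i + 1)).toLinearMap.restrict (hδ i))
  refine ⟨x, fun i => LinearMap.det ((S.autB T i).toLinearMap.restrict (ha i)),
    fun i => LinearMap.det ((S.autC T i).toLinearMap.restrict (hb i)), rfl, ?_,
    fun i => ⟨?_, ?_, ?_⟩⟩
  -- The image of the last connecting map lies in `A (n + 1) = 0`.
  · have := hL.zeroA (n + 1) n.lt_succ_self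
    exact LinearMap.det_eq_one_of_subsingleton _
  · cases i with
    | zero =>
      -- In degree zero the incoming map is replaced by a zero map, which is exact against the
      -- injective `a 0`.
      have h0 : Function.Exact (0 : L.A 0 →ₗ[ℂ] L.A 0) (L.a 0) :=
        LinearMap.exact_iff.2 ((LinearMap.ker_eq_bot.2 L.injective_a).trans
          LinearMap.range_zero.symm)
      have h1 : ∀ x ∈ LinearMap.range (0 : L.A 0 →ₗ[ℂ] L.A 0),
          S.autA T 0 x ∈ LinearMap.range (0 : L.A 0 →ₗ[ℂ] L.A 0) := by
        rintro _ ⟨x, rfl⟩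
        exact ⟨0, by simp⟩
      have h2 : Subsingleton (LinearMap.range (0 : L.A 0 →ₗ[ℂ] L.A 0)) := by
        rw [LinearMap.range_zero]
        infer_instance
      rw [det_eq_det_range_mul_det_range h0 _ _ h1 (ha 0) (S.a_autA T 0),
        LinearMap.det_eq_one_of_subsingleton]
    | succ i =>
      exact det_eq_det_range_mul_det_range (L.exact_δ_a i) _ _ (hδ i) (ha (i + 1)) (S.a_autA T _)
  · exact det_eq_det_range_mul_det_range (L.exact_a_b i) _ _ (ha i) (hb i) (S.b_autB T i)
  · exact det_eq_det_range_mul_det_range (L.exact_b_δ i) _ _ (hb i) (hδ i) (S.δ_autC T i)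

/-- Telescoping: for `0 < i < k`, `x i` occurs in the factors `i - 1` and `i` with opposite
exponents, so only the two ends remain. -/
theorem prod_alternating_mul_succ {K : Type*} [Field K] (x : ℕ → K) (hx : ∀ i, x i ≠ 0) (k : ℕ) :
    ∏ i ∈ Finset.range k, (bif i.bodd then (x i * x (i + 1))⁻¹ else x i * x (i + 1)) =
      x 0 * bif k.bodd then x k else (x k)⁻¹ := by
  induction k with
  | zero => simp [hx 0]
  | succ k ih =>
    have := hx k
    have := hx (k + 1)
    rw [Finset.prod_range_succ, ih, Nat.bodd_succ]
    cases k.bodd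
    · simp only [cond_false, cond_true, Bool.not_false]
      field_simp
    · simp only [cond_false, cond_true, Bool.not_true]
      field_simp

/-- The alternating product of the determinants of the automorphisms that relate two families of
adapted bases is trivial. -/
theorem prod_norm_det {n : ℕ} (hL : L.IsFinite n) :
    (∏ i ∈ Finset.range (n + 1),
        bif i.bodd then ‖LinearMap.det (S.autC T i : L.C i →ₗ[ℂ] L.C i)‖⁻¹
        else ‖LinearMap.det (S.autC T i : L.C i →ₗ[ℂ] L.C i)‖) *
      (∏ i ∈ Finset.range (n + 1),
        bif i.bodd then ‖LinearMap.det (S.autA T i : L.A i →ₗ[ℂ] L.A i)‖⁻¹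
        else ‖LinearMap.det (S.autA T i : L.A i →ₗ[ℂ] L.A i)‖) =
      ∏ i ∈ Finset.range (n + 1),
        bif i.bodd then ‖LinearMap.det (S.autB T i : L.B i →ₗ[ℂ] L.B i)‖⁻¹
        else ‖LinearMap.det (S.autB T i : L.B i →ₗ[ℂ] L.B i)‖ := by
  obtain ⟨x, y, z, hx0, hxn, h⟩ := S.exists_det_factors T hL
  have hA : ∀ i, x i * y i ≠ 0 := fun i => (h i).1 ▸ (LinearEquiv.isUnit_det' _).ne_zero
  have hB : ∀ i, y i * z i ≠ 0 := fun i => (h i).2.1 ▸ (LinearEquiv.isUnit_det' _).ne_zero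
  have hx : ∀ i, ‖x i‖ ≠ 0 := fun i => norm_ne_zero_iff.2 (left_ne_zero_of_mul (hA i))
  -- The `y` and `z` factors agree on both sides of the goal; the left side has in addition the
  -- alternating product of `x i * x (i + 1)`, whose ends `x 0` and `x (n + 1)` are both 1.
  have key := prod_alternating_mul_succ (fun i => ‖x i‖) hx (n + 1)
  have hone : (‖x 0‖ * bif (n + 1).bodd then ‖x (n + 1)‖ else ‖x (n + 1)‖⁻¹) = 1 := by
    rw [hx0, hxn]
    simp
  rw [hone] at key
  refine Eq.trans ?_ (one_mul _)
  rw [← key, ← Finset.prod_mul_distrib, ← Finset.prod_mul_distrib]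
  refine Finset.prod_congr rfl fun i _ => ?_
  rw [(h i).1, (h i).2.1, (h i).2.2]
  simp only [norm_mul]
  cases i.bodd
  · simp only [cond_false]
    ring
  · simp only [cond_true, mul_inv]
    ring

theorem reindex_finSum_inl {W : Type*} [AddCommGroup W] [Module ℂ W] {k l : ℕ}
    (b : Module.Basis (Fin (k + l)) ℂ W) (j : Fin k) :
    b.reindex finSumFinEquiv.symm (.inl j) = b (Fin.castAdd l j) := by
  simp

theorem reindex_finSum_inr {W : Type*} [AddCommGroup W] [Module ℂ W] {k l : ℕ}
    (b : Module.Basis (Fin (k + l)) ℂ W) (j : Fin l) :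
    b.reindex finSumFinEquiv.symm (.inr j) = b (Fin.natAdd k j) := by
  simp

theorem reindex_finSum_reindex {W : Type*} [AddCommGroup W] [Module ℂ W] {k l : ℕ}
    (b : Module.Basis (Fin (k + l)) ℂ W) :
    b = (b.reindex finSumFinEquiv.symm).reindex finSumFinEquiv :=
  Module.Basis.eq_of_apply_eq fun j => by simp

/-- Adapted bases, reindexed. -/
noncomputable def ofAdaptedBases (D : L.AdaptedBases) : L.SplitBases where
  R i := Fin (prev D.r i)
  P i := Fin (D.p i)
  Q i := Fin (D.q i)
  fintypeR _ := inferInstance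
  fintypeP _ := inferInstance
  fintypeQ _ := inferInstance
  isEmpty_R := Fin.isEmpty'
  basisA i := (D.basisA i).reindex finSumFinEquiv.symm
  basisB i := (D.basisB i).reindex finSumFinEquiv.symm
  basisC i := (D.basisC i).reindex finSumFinEquiv.symm
  map_a i j := (congrArg (L.a i) (reindex_finSum_inr (D.basisA i) j)).trans
    ((D.map_a i j).symm.trans (reindex_finSum_inl (D.basisB i) j).symm)
  map_b i j := (congrArg (L.b i) (reindex_finSum_inr (D.basisB i) j)).trans
    ((D.map_b i j).symm.trans (reindex_finSum_inl (D.basisC i) j).symm)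
  map_δ i j := (congrArg (L.δ i) (reindex_finSum_inr (D.basisC i) j)).trans
    ((D.map_δ i j).symm.trans (reindex_finSum_inl (D.basisA (i + 1)) j).symm)

/-- The isomorphism of determinant lines of a long exact sequence is given, up to a factor of
modulus one, by the generators defined by any adapted bases. -/
theorem detMap_gradedVol {n : ℕ} (hL : L.IsFinite n) :
    ∃ μ : ℂ, ‖μ‖ = 1 ∧ L.detMap n (gradedVol n (fun i => (S.basisC i).enum) ⊗ₜ[ℂ]
      gradedVol n (fun i => (S.basisA i).enum)) = μ • gradedVol n fun i => (S.basisB i).enum := by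
  rw [detMap, dif_pos hL]
  generalize (nonempty_adaptedBases hL).some = D
  have hA : D.basisA = fun i => ((ofAdaptedBases D).basisA i).reindex finSumFinEquiv :=
    funext fun i => reindex_finSum_reindex (D.basisA i)
  have hB : D.basisB = fun i => ((ofAdaptedBases D).basisB i).reindex finSumFinEquiv :=
    funext fun i => reindex_finSum_reindex (D.basisB i)
  have hC : D.basisC = fun i => ((ofAdaptedBases D).basisC i).reindex finSumFinEquiv :=
    funext fun i => reindex_finSum_reindex (D.basisC i)
  have nA := norm_gradedVolCoord_gradedVol n (ofAdaptedBases D).basisA S.basisA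
    (fun i => Equiv.sumCongr ((ofAdaptedBases D).equivR S i) ((ofAdaptedBases D).equivP S i))
    (fun i => finSumFinEquiv) (fun i => Fintype.equivFin _)
  have nB := norm_gradedVolCoord_gradedVol n (ofAdaptedBases D).basisB S.basisB
    (fun i => Equiv.sumCongr ((ofAdaptedBases D).equivP S i) ((ofAdaptedBases D).equivQ S i))
    (fun i => finSumFinEquiv) (fun i => Fintype.equivFin _)
  have nC := norm_gradedVolCoord_gradedVol n (ofAdaptedBases D).basisC S.basisC
    (fun i => Equiv.sumCongr ((ofAdaptedBases D).equivQ S i) ((ofAdaptedBases D).equivR S (i + 1)))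
    (fun i => finSumFinEquiv) (fun i => Fintype.equivFin _)
  rw [← hA] at nA
  rw [← hB] at nB
  rw [← hC] at nC
  have hprod := (congrArg₂ (· * ·) nC nA).trans (((ofAdaptedBases D).prod_norm_det S hL).trans
    nB.symm)
  have hne : gradedVolCoord n D.basisB (gradedVol n fun i => (S.basisB i).enum) ≠ 0 := by
    intro h0
    have h1 := gradedVolCoord_gradedVol n fun i => (S.basisB i).enum
    rw [← gradedVolCoord_smul_gradedVol n D.basisB (gradedVol n fun i => (S.basisB i).enum), h0,
      zero_smul, map_zero] at h1
    exact zero_ne_one h1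
  -- In the generators of `D`, for which `detIso` is normalised, the isomorphism preserves
  -- coordinates; the phase is thus the quotient of the coordinates of the generators of `S`.
  refine ⟨gradedVolCoord n D.basisC (gradedVol n fun i => (S.basisC i).enum) *
    gradedVolCoord n D.basisA (gradedVol n fun i => (S.basisA i).enum) /
      gradedVolCoord n D.basisB (gradedVol n fun i => (S.basisB i).enum), ?_, ?_⟩
  · rw [norm_div, norm_mul]
    refine (div_eq_one_iff_eq (norm_ne_zero_iff.2 hne)).2 hprod
  · conv_lhs => rw [← gradedVolCoord_smul_gradedVol n D.basisC (gradedVol n _),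
      ← gradedVolCoord_smul_gradedVol n D.basisA (gradedVol n fun i => (S.basisA i).enum),
      TensorProduct.smul_tmul_smul, map_smul]
    refine (congrArg _ (D.detIso_gradedVol n)).trans ?_
    refine Eq.trans ?_ (congrArg _ (gradedVolCoord_smul_gradedVol n D.basisB _))
    rw [smul_smul, div_mul_cancel₀ _ hne]

end SplitBases
end LongExactSequence

/-! ### Bases assembled along a filtration -/

section LinearAlgebra

variable {K V W : Type*} [Field K] [AddCommGroup V] [Module K V] [AddCommGroup W] [Module K W]

/-- A basis of the part of a subspace `N` killed by a linear map, together with lifts to `N` of a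
basis of the image of `N`, is a basis of `N`. -/
theorem linearIndependent_elim_and_span_eq {ι κ : Type*} {N : Submodule K V} (f : V →ₗ[K] W)
    {u : ι → V} {v : κ → V}
    (hu : LinearIndependent K u ∧ Submodule.span K (range u) = N ⊓ LinearMap.ker f)
    (hvN : ∀ j, v j ∈ N)
    (hv : LinearIndependent K (fun j => f (v j)) ∧
      Submodule.span K (range fun j => f (v j)) = N.map f) :
    LinearIndependent K (Sum.elim u v) ∧ Submodule.span K (range (Sum.elim u v)) = N := by
  have hv1 : LinearIndependent K (f ∘ v) := hv.1
  have hv2 : Submodule.span K (range (f ∘ v)) = N.map f := hv.2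
  have hvs : Submodule.span K (range v) ≤ N := Submodule.span_le.2 (range_subset_iff.2 hvN)
  refine ⟨hu.1.sum_type (hv1.of_comp f) ?_, le_antisymm ?_ ?_⟩
  · exact (Submodule.range_ker_disjoint hv1).symm.mono_left (hu.2.trans_le inf_le_right)
  · rw [Sum.elim_range, Submodule.span_union, hu.2]
    exact sup_le inf_le_left hvs
  · intro x hx
    rw [Sum.elim_range, Submodule.span_union, hu.2]
    have hfx : f x ∈ Submodule.map f (Submodule.span K (range v)) := by
      rw [Submodule.map_span, ← range_comp, hv2]
      exact ⟨x, hx, rfl⟩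
    obtain ⟨y, hy, hyx⟩ := hfx
    refine Submodule.mem_sup.2 ⟨x - y, ⟨N.sub_mem hx (hvs hy), ?_⟩, y, hy, sub_add_cancel x y⟩
    rw [SetLike.mem_coe, LinearMap.mem_ker, map_sub, hyx, sub_self]

end LinearAlgebra

/-! ### Exact braids and the families that split them -/

/-- Four interlocking long exact sequences `a → b → c`, `a → d → e`, `b → d → f` and `c → e → f`
that form a commutative braid. -/
structure ExactBraid where
  a : ℕ → ModuleCat.{u} ℂ
  b : ℕ → ModuleCat.{u} ℂ
  c : ℕ → ModuleCat.{u} ℂ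
  d : ℕ → ModuleCat.{u} ℂ
  e : ℕ → ModuleCat.{u} ℂ
  f : ℕ → ModuleCat.{u} ℂ
  ab : ∀ i, a i →ₗ[ℂ] b i
  bc : ∀ i, b i →ₗ[ℂ] c i
  ca : ∀ i, c i →ₗ[ℂ] a (i + 1)
  ad : ∀ i, a i →ₗ[ℂ] d i
  de : ∀ i, d i →ₗ[ℂ] e i
  ea : ∀ i, e i →ₗ[ℂ] a (i + 1)
  bd : ∀ i, b i →ₗ[ℂ] d i
  df : ∀ i, d i →ₗ[ℂ] f i
  fb : ∀ i, f i →ₗ[ℂ] b (i + 1)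
  ce : ∀ i, c i →ₗ[ℂ] e i
  ef : ∀ i, e i →ₗ[ℂ] f i
  fc : ∀ i, f i →ₗ[ℂ] c (i + 1)
  injective_ab : Function.Injective (ab 0)
  injective_ad : Function.Injective (ad 0)
  injective_bd : Function.Injective (bd 0)
  injective_ce : Function.Injective (ce 0)
  exact_ab_bc : ∀ i, Function.Exact (ab i) (bc i)
  exact_bc_ca : ∀ i, Function.Exact (bc i) (ca i)
  exact_ca_ab : ∀ i, Function.Exact (ca i) (ab (i + 1))
  exact_ad_de : ∀ i, Function.Exact (ad i) (de i)
  exact_de_ea : ∀ i, Function.Exact (de i) (ea i)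
  exact_ea_ad : ∀ i, Function.Exact (ea i) (ad (i + 1))
  exact_bd_df : ∀ i, Function.Exact (bd i) (df i)
  exact_df_fb : ∀ i, Function.Exact (df i) (fb i)
  exact_fb_bd : ∀ i, Function.Exact (fb i) (bd (i + 1))
  exact_ce_ef : ∀ i, Function.Exact (ce i) (ef i)
  exact_ef_fc : ∀ i, Function.Exact (ef i) (fc i)
  exact_fc_ce : ∀ i, Function.Exact (fc i) (ce (i + 1))
  bd_ab : ∀ i x, bd i (ab i x) = ad i x
  de_bd : ∀ i x, de i (bd i x) = ce i (bc i x)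
  ef_de : ∀ i x, ef i (de i x) = df i x
  ea_ce : ∀ i x, ea i (ce i x) = ca i x
  ab_ea : ∀ i x, ab (i + 1) (ea i x) = fb i (ef i x)
  bc_fb : ∀ i x, bc (i + 1) (fb i x) = fc i x

namespace ExactBraid

/-- The long exact sequence `a → b → c → a[1]`. -/
abbrev abc (S : ExactBraid.{u}) : LongExactSequence.{u} :=
  ⟨S.a, S.b, S.c, S.ab, S.bc, S.ca, S.injective_ab, S.exact_ab_bc, S.exact_bc_ca, S.exact_ca_ab⟩

/-- The long exact sequence `a → d → e → a[1]`. -/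
abbrev ade (S : ExactBraid.{u}) : LongExactSequence.{u} :=
  ⟨S.a, S.d, S.e, S.ad, S.de, S.ea, S.injective_ad, S.exact_ad_de, S.exact_de_ea, S.exact_ea_ad⟩

/-- The long exact sequence `b → d → f → b[1]`. -/
abbrev bdf (S : ExactBraid.{u}) : LongExactSequence.{u} :=
  ⟨S.b, S.d, S.f, S.bd, S.df, S.fb, S.injective_bd, S.exact_bd_df, S.exact_df_fb, S.exact_fb_bd⟩

/-- The long exact sequence `c → e → f → c[1]`. -/
abbrev cef (S : ExactBraid.{u}) : LongExactSequence.{u} :=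
  ⟨S.c, S.e, S.f, S.ce, S.ef, S.fc, S.injective_ce, S.exact_ce_ef, S.exact_ef_fc, S.exact_fc_ce⟩

/-- Families of vectors that decompose an exact braid into elementary ones. Each of the six families
`α, γ, ζ, ψ, φ, ρ` consists of vectors at the first spot of the braid where they are nonzero; `ψ'`,
`φ'`, `ρ'` are the images of `ψ`, `φ`, `ρ` in the following degree. -/
structure Families (S : ExactBraid.{u}) where
  Al : ℕ → Type
  Ga : ℕ → Type
  Ze : ℕ → Type
  Ps : ℕ → Type
  Ph : ℕ → Type
  Rh : ℕ → Type
  fintypeAl : ∀ i, Fintype (Al i)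
  fintypeGa : ∀ i, Fintype (Ga i)
  fintypeZe : ∀ i, Fintype (Ze i)
  fintypePs : ∀ i, Fintype (Ps i)
  fintypePh : ∀ i, Fintype (Ph i)
  fintypeRh : ∀ i, Fintype (Rh i)
  isEmpty_Ps : IsEmpty (Ps 0)
  isEmpty_Ph : IsEmpty (Ph 0)
  isEmpty_Rh : IsEmpty (Rh 0)
  α : ∀ i, Al i → S.a i
  γ : ∀ i, Ga i → S.b i
  ζ : ∀ i, Ze i → S.d i
  ψ : ∀ i, Ps (i + 1) → S.c i
  φ : ∀ i, Ph (i + 1) → S.e i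
  ρ : ∀ i, Rh (i + 1) → S.f i
  ψ' : ∀ i, Ps i → S.a i
  φ' : ∀ i, Ph i → S.a i
  ρ' : ∀ i, Rh i → S.b i
  ca_ψ : ∀ i j, S.ca i (ψ i j) = ψ' (i + 1) j
  ea_φ : ∀ i j, S.ea i (φ i j) = φ' (i + 1) j
  fb_ρ : ∀ i j, S.fb i (ρ i j) = ρ' (i + 1) j
  ad_φ' : ∀ i j, S.ad i (φ' i j) = 0
  bd_ρ' : ∀ i j, S.bd i (ρ' i j) = 0
  basis_α : ∀ i, LinearIndependent ℂ (fun j => S.ad i (α i j)) ∧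
    Submodule.span ℂ (range fun j => S.ad i (α i j)) = LinearMap.range (S.ad i)
  basis_γ : ∀ i, LinearIndependent ℂ (fun j => S.de i (S.bd i (γ i j))) ∧
    Submodule.span ℂ (range fun j => S.de i (S.bd i (γ i j))) =
      LinearMap.range (S.de i ∘ₗ S.bd i)
  basis_ζ : ∀ i, LinearIndependent ℂ (fun j => S.df i (ζ i j)) ∧
    Submodule.span ℂ (range fun j => S.df i (ζ i j)) = LinearMap.range (S.df i)
  basis_ψ' : ∀ i, LinearIndependent ℂ (ψ' i) ∧
    Submodule.span ℂ (range (ψ' i)) = LinearMap.ker (S.ab i)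
  basis_φ' : ∀ i, LinearIndependent ℂ (fun j => S.ab i (φ' i j)) ∧
    Submodule.span ℂ (range fun j => S.ab i (φ' i j)) = (LinearMap.ker (S.ad i)).map (S.ab i)
  basis_ρ' : ∀ i, LinearIndependent ℂ (fun j => S.bc i (ρ' i j)) ∧
    Submodule.span ℂ (range fun j => S.bc i (ρ' i j)) = LinearMap.ker (S.ce i)

attribute [instance] Families.fintypeAl Families.fintypeGa Families.fintypeZe Families.fintypePs
  Families.fintypePh Families.fintypeRh

/-- The six families lift bases of the images of `ad`, `de ∘ bd`, `df`, `ca`, `ab ∘ ea` and `fc`;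
exactness rewrites the last three images as the spaces spanned by the primed families. In degree
zero those spaces vanish by injectivity, so empty families serve. -/
theorem nonempty_families (S : ExactBraid.{u}) (ha : ∀ i, FiniteDimensional ℂ (S.a i))
    (hb : ∀ i, FiniteDimensional ℂ (S.b i)) (hc : ∀ i, FiniteDimensional ℂ (S.c i))
    (hd : ∀ i, FiniteDimensional ℂ (S.d i)) (he : ∀ i, FiniteDimensional ℂ (S.e i))
    (hf : ∀ i, FiniteDimensional ℂ (S.f i)) : Nonempty S.Families := by
  have ker0 {V W : ModuleCat.{u} ℂ} {g : V →ₗ[ℂ] W} (hg : Function.Injective g) :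
      LinearMap.ker g = ⊥ := LinearMap.ker_eq_bot.2 hg
  have empty {V : ModuleCat.{u} ℂ} (v : Fin 0 → V) : LinearIndependent ℂ v ∧
      Submodule.span ℂ (range v) = ⊥ :=
    ⟨linearIndependent_empty_type, by rw [range_eq_empty, Submodule.span_empty]⟩
  choose α hα using fun i => LongExactSequence.exists_lift_basis_range (S.ad i)
  choose γ hγ using fun i => LongExactSequence.exists_lift_basis_range (S.de i ∘ₗ S.bd i)
  choose ζ hζ using fun i => LongExactSequence.exists_lift_basis_range (S.df i)
  choose ψ hψ using fun i => LongExactSequence.exists_lift_basis_range (S.ca i)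
  choose φ hφ using fun i => LongExactSequence.exists_lift_basis_range (S.ab (i + 1) ∘ₗ S.ea i)
  choose ρ hρ using fun i => LongExactSequence.exists_lift_basis_range (S.fc i)
  let nψ : ℕ → ℕ := fun i => Module.finrank ℂ (LinearMap.range (S.ca i))
  let nφ : ℕ → ℕ := fun i => Module.finrank ℂ (LinearMap.range (S.ab (i + 1) ∘ₗ S.ea i))
  let nρ : ℕ → ℕ := fun i => Module.finrank ℂ (LinearMap.range (S.fc i))
  let ψ' : ∀ i, Fin (LongExactSequence.prev nψ i) → S.a i := fun i => match i with
    | 0 => Fin.elim0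
    | i + 1 => fun j => S.ca i (ψ i j)
  let φ' : ∀ i, Fin (LongExactSequence.prev nφ i) → S.a i := fun i => match i with
    | 0 => Fin.elim0
    | i + 1 => fun j => S.ea i (φ i j)
  let ρ' : ∀ i, Fin (LongExactSequence.prev nρ i) → S.b i := fun i => match i with
    | 0 => Fin.elim0
    | i + 1 => fun j => S.fb i (ρ i j)
  exact ⟨{
    Al := _
    Ga := _
    Ze := _
    Ps := fun i => Fin (LongExactSequence.prev nψ i)
    Ph := fun i => Fin (LongExactSequence.prev nφ i)
    Rh := fun i => Fin (LongExactSequence.prev nρ i)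
    fintypeAl := fun _ => inferInstance
    fintypeGa := fun _ => inferInstance
    fintypeZe := fun _ => inferInstance
    fintypePs := fun _ => inferInstance
    fintypePh := fun _ => inferInstance
    fintypeRh := fun _ => inferInstance
    isEmpty_Ps := Fin.isEmpty'
    isEmpty_Ph := Fin.isEmpty'
    isEmpty_Rh := Fin.isEmpty'
    α := α
    γ := γ
    ζ := ζ
    ψ := ψ
    φ := φ
    ρ := ρ
    ψ' := ψ'
    φ' := φ'
    ρ' := ρ'
    ca_ψ := fun _ _ => rfl
    ea_φ := fun _ _ => rfl
    fb_ρ := fun _ _ => rfl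
    ad_φ' := fun i => match i with
      | 0 => fun j => Fin.elim0 j
      | i + 1 => fun j => (S.exact_ea_ad i).apply_apply_eq_zero _
    bd_ρ' := fun i => match i with
      | 0 => fun j => Fin.elim0 j
      | i + 1 => fun j => (S.exact_fb_bd i).apply_apply_eq_zero _
    basis_α := hα
    basis_γ := hγ
    basis_ζ := hζ
    basis_ψ' := fun i => match i with
      | 0 => by
        rw [ker0 S.injective_ab]
        exact empty _
      | i + 1 => by
        rw [(S.exact_ca_ab i).linearMap_ker_eq]
        exact hψ i
    basis_φ' := fun i => match i with
      | 0 => by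
        rw [ker0 S.injective_ad, Submodule.map_bot]
        exact empty _
      | i + 1 => by
        rw [(S.exact_ea_ad i).linearMap_ker_eq, ← LinearMap.range_comp]
        exact hφ i
    basis_ρ' := fun i => match i with
      | 0 => by
        rw [ker0 S.injective_ce]
        exact empty _
      | i + 1 => by
        rw [(S.exact_fc_ce i).linearMap_ker_eq]
        -- The lifts `ρ` were chosen for `fc`, which factors as `bc ∘ fb`.
        have h : (fun j => S.bc (i + 1) (ρ' (i + 1) j)) = S.fc i ∘ ρ i :=
          funext fun j => S.bc_fb i _
        rw [h]
        exact hρ i }⟩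

/-! ### Bases of the six terms of a braid -/

namespace Families

variable {S : ExactBraid.{u}} (T : S.Families)

/-- Filtration `ker ab ⊆ ker ad ⊆ a`, the inclusion because `ad = bd ∘ ab`. Its pieces `ker ab`, `ab
(ker ad)`, `range ad` belong to `ψ'`, `φ'`, `α`. -/
theorem exists_basis_a (i : ℕ) : ∃ b : Module.Basis ((T.Ps i ⊕ T.Ph i) ⊕ T.Al i) ℂ (S.a i),
    ⇑b = Sum.elim (Sum.elim (T.ψ' i) (T.φ' i)) (T.α i) := by
  have h1 := linearIndependent_elim_and_span_eq (N := LinearMap.ker (S.ad i)) (S.ab i)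
    (u := T.ψ' i) (v := T.φ' i) ⟨(T.basis_ψ' i).1, (T.basis_ψ' i).2.trans ?_⟩ (T.ad_φ' i)
    (T.basis_φ' i)
  · have h2 := linearIndependent_elim_and_span_eq (N := ⊤) (S.ad i) (v := T.α i)
      ⟨h1.1, h1.2.trans (top_inf_eq _).symm⟩ (fun _ => trivial)
      ⟨(T.basis_α i).1, (T.basis_α i).2.trans (Submodule.map_top _).symm⟩
    exact ⟨Module.Basis.mk h2.1 h2.2.ge, Module.Basis.coe_mk _ _⟩
  · refine (inf_eq_right.2 fun x hx => ?_).symm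
    rw [LinearMap.mem_ker] at hx ⊢
    rw [← S.bd_ab, hx, map_zero]

/-- Filtration `ab (ker ad) ⊆ range ab ⊆ ker (de ∘ bd) ⊆ b`. Its successive pieces are `ab (ker
ad)`, `range ad` (through `bd`), `ker ce` (through `bc`) and `range (de ∘ bd)`. -/
theorem exists_basis_b (i : ℕ) :
    ∃ b : Module.Basis (((T.Ph i ⊕ T.Al i) ⊕ T.Rh i) ⊕ T.Ga i) ℂ (S.b i),
      ⇑b = Sum.elim (Sum.elim (Sum.elim (fun j => S.ab i (T.φ' i j)) fun j => S.ab i (T.α i j))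
        (T.ρ' i)) (T.γ i) := by
  have h1 := linearIndependent_elim_and_span_eq (N := LinearMap.range (S.ab i)) (S.bd i)
    (v := fun j => S.ab i (T.α i j)) ⟨(T.basis_φ' i).1, (T.basis_φ' i).2.trans ?_⟩
    (fun j => ⟨_, rfl⟩) ?_
  · have h2 := linearIndependent_elim_and_span_eq (N := LinearMap.ker (S.de i ∘ₗ S.bd i)) (S.bc i)
      (v := T.ρ' i) ⟨h1.1, h1.2.trans ?_⟩ (fun j => ?_) ⟨(T.basis_ρ' i).1,
        (T.basis_ρ' i).2.trans ?_⟩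
    · have h3 := linearIndependent_elim_and_span_eq (N := ⊤) (S.de i ∘ₗ S.bd i) (v := T.γ i)
        ⟨h2.1, h2.2.trans (top_inf_eq _).symm⟩ (fun _ => trivial)
        ⟨(T.basis_γ i).1, (T.basis_γ i).2.trans (Submodule.map_top _).symm⟩
      exact ⟨Module.Basis.mk h3.1 h3.2.ge, Module.Basis.coe_mk _ _⟩
    · rw [← (S.exact_ab_bc i).linearMap_ker_eq]
      refine (inf_eq_right.2 fun x hx => ?_).symm
      rw [LinearMap.mem_ker] at hx ⊢
      rw [LinearMap.comp_apply, S.de_bd, hx, map_zero]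
    · rw [LinearMap.mem_ker, LinearMap.comp_apply, T.bd_ρ', map_zero]
    -- The identity `ker ce = bc (ker (de ∘ bd))`: a vector killed by `ce` is killed by `ca = ea ∘
    -- ce`, hence lifts to `b`.
    · ext x
      constructor
      · intro hx
        rw [LinearMap.mem_ker] at hx
        obtain ⟨y, rfl⟩ := (S.exact_bc_ca i x).1 (by rw [← S.ea_ce, hx, map_zero])
        exact ⟨y, (S.de_bd i y).trans hx, rfl⟩
      · rintro ⟨y, hy, rfl⟩
        exact (S.de_bd i y).symm.trans hy
  · ext x
    constructor
    · rintro ⟨y, hy, rfl⟩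
      exact ⟨⟨y, rfl⟩, (S.bd_ab i y).trans hy⟩
    · rintro ⟨⟨y, rfl⟩, hy⟩
      exact ⟨y, (S.bd_ab i y).symm.trans hy, rfl⟩
  · rw [← LinearMap.range_comp]
    have h : S.bd i ∘ₗ S.ab i = S.ad i := LinearMap.ext (S.bd_ab i)
    simp only [S.bd_ab, h]
    exact T.basis_α i

/-- Filtration `ker ce ⊆ ker ca = range bc ⊆ c`, with pieces `ker ce`, `range (de ∘ bd)` (through
`ce`) and `range ca`. -/
theorem exists_basis_c (i : ℕ) : ∃ b : Module.Basis ((T.Rh i ⊕ T.Ga i) ⊕ T.Ps (i + 1)) ℂ (S.c i),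
    ⇑b = Sum.elim (Sum.elim (fun j => S.bc i (T.ρ' i j)) fun j => S.bc i (T.γ i j)) (T.ψ i) := by
  have h1 := linearIndependent_elim_and_span_eq (N := LinearMap.ker (S.ca i)) (S.ce i)
    (v := fun j => S.bc i (T.γ i j)) ⟨(T.basis_ρ' i).1, (T.basis_ρ' i).2.trans ?_⟩
    (fun j => (S.exact_bc_ca i).apply_apply_eq_zero _) ?_
  · have h2 := linearIndependent_elim_and_span_eq (N := ⊤) (S.ca i) (v := T.ψ i)
      ⟨h1.1, h1.2.trans (top_inf_eq _).symm⟩ (fun _ => trivial) ?_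
    · exact ⟨Module.Basis.mk h2.1 h2.2.ge, Module.Basis.coe_mk _ _⟩
    · rw [Submodule.map_top, ← (S.exact_ca_ab i).linearMap_ker_eq]
      simp only [T.ca_ψ]
      exact T.basis_ψ' (i + 1)
  · refine (inf_eq_right.2 fun x hx => ?_).symm
    rw [LinearMap.mem_ker] at hx ⊢
    rw [← S.ea_ce, hx, map_zero]
  · have h : S.ce i ∘ₗ S.bc i = S.de i ∘ₗ S.bd i := LinearMap.ext fun x => (S.de_bd i x).symm
    rw [(S.exact_bc_ca i).linearMap_ker_eq, ← LinearMap.range_comp, h]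
    simp only [← S.de_bd]
    exact T.basis_γ i

/-- Filtration `range ad ⊆ range bd ⊆ d`, with pieces `range ad`, `range (de ∘ bd)` (through `de`)
and `range df`. -/
theorem exists_basis_d (i : ℕ) : ∃ b : Module.Basis ((T.Al i ⊕ T.Ga i) ⊕ T.Ze i) ℂ (S.d i),
    ⇑b = Sum.elim (Sum.elim (fun j => S.ad i (T.α i j)) fun j => S.bd i (T.γ i j)) (T.ζ i) := by
  have h1 := linearIndependent_elim_and_span_eq (N := LinearMap.ker (S.df i)) (S.de i)
    (v := fun j => S.bd i (T.γ i j)) ⟨(T.basis_α i).1, (T.basis_α i).2.trans ?_⟩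
    (fun j => (S.exact_bd_df i).apply_apply_eq_zero _) ?_
  · have h2 := linearIndependent_elim_and_span_eq (N := ⊤) (S.df i) (v := T.ζ i)
      ⟨h1.1, h1.2.trans (top_inf_eq _).symm⟩ (fun _ => trivial)
      ⟨(T.basis_ζ i).1, (T.basis_ζ i).2.trans (Submodule.map_top _).symm⟩
    exact ⟨Module.Basis.mk h2.1 h2.2.ge, Module.Basis.coe_mk _ _⟩
  · rw [← (S.exact_ad_de i).linearMap_ker_eq]
    refine (inf_eq_right.2 fun x hx => ?_).symm
    rw [LinearMap.mem_ker] at hx ⊢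
    rw [← S.ef_de, hx, map_zero]
  · rw [(S.exact_bd_df i).linearMap_ker_eq, ← LinearMap.range_comp]
    exact T.basis_γ i

/-- Filtration `range (de ∘ bd) ⊆ ker ef ⊆ ker (ab ∘ ea) ⊆ e`. Its successive pieces are `range (de
∘ bd)`, `range ca` (through `ea`), `range df` (through `ef`) and `range (ab ∘ ea)`. -/
theorem exists_basis_e (i : ℕ) :
    ∃ b : Module.Basis (((T.Ga i ⊕ T.Ps (i + 1)) ⊕ T.Ze i) ⊕ T.Ph (i + 1)) ℂ (S.e i),
      ⇑b = Sum.elim (Sum.elim (Sum.elim (fun j => S.de i (S.bd i (T.γ i j)))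
        fun j => S.ce i (T.ψ i j)) fun j => S.de i (T.ζ i j)) (T.φ i) := by
  have h1 := linearIndependent_elim_and_span_eq (N := LinearMap.ker (S.ef i)) (S.ea i)
    (v := fun j => S.ce i (T.ψ i j)) ⟨(T.basis_γ i).1, (T.basis_γ i).2.trans ?_⟩
    (fun j => (S.exact_ce_ef i).apply_apply_eq_zero _) ?_
  · have h2 := linearIndependent_elim_and_span_eq (N := LinearMap.ker (S.ab (i + 1) ∘ₗ S.ea i))
      (S.ef i) (v := fun j => S.de i (T.ζ i j)) ⟨h1.1, h1.2.trans ?_⟩ (fun j => ?_) ?_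
    · have h3 := linearIndependent_elim_and_span_eq (N := ⊤) (S.ab (i + 1) ∘ₗ S.ea i) (v := T.φ i)
        ⟨h2.1, h2.2.trans (top_inf_eq _).symm⟩ (fun _ => trivial) ?_
      · exact ⟨Module.Basis.mk h3.1 h3.2.ge, Module.Basis.coe_mk _ _⟩
      · rw [Submodule.map_top, LinearMap.range_comp, ← (S.exact_ea_ad i).linearMap_ker_eq]
        simp only [LinearMap.comp_apply, T.ea_φ]
        exact T.basis_φ' (i + 1)
    · refine (inf_eq_right.2 fun x hx => ?_).symm
      rw [LinearMap.mem_ker] at hx ⊢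
      rw [LinearMap.comp_apply, S.ab_ea, hx, map_zero]
    · rw [LinearMap.mem_ker, LinearMap.comp_apply, (S.exact_de_ea i).apply_apply_eq_zero, map_zero]
    · simp only [S.ef_de]
      refine ⟨(T.basis_ζ i).1, (T.basis_ζ i).2.trans ?_⟩
      -- The identity `range df = ef (ker (ab ∘ ea))`: since `ab ∘ ea = fb ∘ ef`, the vectors `y` in
      -- that kernel are those with `ef y` in `ker fb = range df`.
      ext x
      constructor
      · rintro ⟨y, rfl⟩
        refine ⟨S.de i y, ?_, S.ef_de i y⟩
        rw [SetLike.mem_coe, LinearMap.mem_ker, LinearMap.comp_apply,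
          (S.exact_de_ea i).apply_apply_eq_zero, map_zero]
      · rintro ⟨y, hy, rfl⟩
        exact (S.exact_df_fb i _).1 ((S.ab_ea i y).symm.trans hy)
  -- The identity `range (de ∘ bd) = ker ef ⊓ ker ea`: a vector of the right side comes from some
  -- `y` in `c`, and `ca y = 0` makes `y` come from `b`.
  · ext x
    constructor
    · rintro ⟨y, rfl⟩
      refine ⟨?_, (S.exact_de_ea i).apply_apply_eq_zero _⟩
      exact (S.ef_de i _).trans ((S.exact_bd_df i).apply_apply_eq_zero _)
    · rintro ⟨hx, hx'⟩
      obtain ⟨y, rfl⟩ := (S.exact_ce_ef i x).1 hx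
      obtain ⟨z, rfl⟩ := (S.exact_bc_ca i y).1 ((S.ea_ce i y).symm.trans hx')
      exact ⟨z, S.de_bd i z⟩
  · have h : S.ea i ∘ₗ S.ce i = S.ca i := LinearMap.ext (S.ea_ce i)
    rw [(S.exact_ce_ef i).linearMap_ker_eq, ← LinearMap.range_comp, h,
      ← (S.exact_ca_ab i).linearMap_ker_eq]
    simp only [S.ea_ce, T.ca_ψ]
    exact T.basis_ψ' (i + 1)

/-- Filtration `range df = ker fb ⊆ ker fc ⊆ f`, with pieces `range df`, `range (ab ∘ ea)` (through
`fb`) and `range fc`. -/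
theorem exists_basis_f (i : ℕ) :
    ∃ b : Module.Basis ((T.Ze i ⊕ T.Ph (i + 1)) ⊕ T.Rh (i + 1)) ℂ (S.f i),
      ⇑b = Sum.elim (Sum.elim (fun j => S.df i (T.ζ i j)) fun j => S.ef i (T.φ i j)) (T.ρ i) := by
  have h1 := linearIndependent_elim_and_span_eq (N := LinearMap.ker (S.fc i)) (S.fb i)
    (v := fun j => S.ef i (T.φ i j)) ⟨(T.basis_ζ i).1, (T.basis_ζ i).2.trans ?_⟩
    (fun j => (S.exact_ef_fc i).apply_apply_eq_zero _) ?_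
  · have h2 := linearIndependent_elim_and_span_eq (N := ⊤) (S.fc i) (v := T.ρ i)
      ⟨h1.1, h1.2.trans (top_inf_eq _).symm⟩ (fun _ => trivial) ?_
    · exact ⟨Module.Basis.mk h2.1 h2.2.ge, Module.Basis.coe_mk _ _⟩
    · rw [Submodule.map_top, ← (S.exact_fc_ce i).linearMap_ker_eq]
      simp only [← S.bc_fb, T.fb_ρ]
      exact T.basis_ρ' (i + 1)
  · rw [← (S.exact_df_fb i).linearMap_ker_eq]
    refine (inf_eq_right.2 fun x hx => ?_).symm
    rw [LinearMap.mem_ker] at hx ⊢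
    rw [← S.bc_fb, hx, map_zero]
  · have h : S.fb i ∘ₗ S.ef i = S.ab (i + 1) ∘ₗ S.ea i :=
      LinearMap.ext fun x => (S.ab_ea i x).symm
    rw [(S.exact_ef_fc i).linearMap_ker_eq, ← LinearMap.range_comp, h, LinearMap.range_comp,
      ← (S.exact_ea_ad i).linearMap_ker_eq]
    simp only [← S.ab_ea, T.ea_φ]
    exact T.basis_φ' (i + 1)

end Families
end ExactBraid

/-! ### Generators in a fixed enumeration, independent of the grouping -/

namespace LongExactSequence

theorem exists_gradedVol_reindex {E : ℕ → ModuleCat.{u} ℂ} {κ κ' : ℕ → Type*}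
    [∀ i, Fintype (κ i)] [∀ i, Fintype (κ' i)] (n : ℕ) (b : ∀ i, Module.Basis (κ i) ℂ (E i))
    (b' : ∀ i, Module.Basis (κ' i) ℂ (E i)) (e : ∀ i, κ i ≃ κ' i)
    (h : ∀ i, b' i = (b i).reindex (e i)) :
    ∃ μ : ℂ, ‖μ‖ = 1 ∧
      gradedVol n (fun i => (b' i).enum) = μ • gradedVol n fun i => (b i).enum := by
  obtain rfl : b' = fun i => (b i).reindex (e i) := funext h
  exact ⟨_, norm_gradedVolCoord_reindex n b e, (gradedVolCoord_smul_gradedVol n _ _).symm⟩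

/-- Each term of a braid lies in two or more of the sequences, and these group its basis
differently. Regrouping costs only a phase, so all sequences can refer to one fixed generator per
term. -/
theorem SplitBases.detMap_gradedVol_of_reindex {L : LongExactSequence.{u}} (S : L.SplitBases)
    {κA κB κC : ℕ → Type} [∀ i, Fintype (κA i)] [∀ i, Fintype (κB i)] [∀ i, Fintype (κC i)]
    (bA : ∀ i, Module.Basis (κA i) ℂ (L.A i)) (bB : ∀ i, Module.Basis (κB i) ℂ (L.B i))
    (bC : ∀ i, Module.Basis (κC i) ℂ (L.C i)) (eA : ∀ i, κA i ≃ S.R i ⊕ S.P i)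
    (eB : ∀ i, κB i ≃ S.P i ⊕ S.Q i) (eC : ∀ i, κC i ≃ S.Q i ⊕ S.R (i + 1))
    (hA : ∀ i, S.basisA i = (bA i).reindex (eA i)) (hB : ∀ i, S.basisB i = (bB i).reindex (eB i))
    (hC : ∀ i, S.basisC i = (bC i).reindex (eC i)) {n : ℕ} (hL : L.IsFinite n) :
    ∃ μ : ℂ, ‖μ‖ = 1 ∧ L.detMap n (gradedVol n (fun i => (bC i).enum) ⊗ₜ[ℂ]
      gradedVol n (fun i => (bA i).enum)) = μ • gradedVol n fun i => (bB i).enum := by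
  obtain ⟨μ, hμ, h⟩ := S.detMap_gradedVol hL
  obtain ⟨x, hx, hxA⟩ := exists_gradedVol_reindex n bA S.basisA eA hA
  obtain ⟨y, hy, hyB⟩ := exists_gradedVol_reindex n bB S.basisB eB hB
  obtain ⟨z, hz, hzC⟩ := exists_gradedVol_reindex n bC S.basisC eC hC
  rw [hxA, hyB, hzC, TensorProduct.smul_tmul_smul, map_smul] at h
  have hzx : z * x ≠ 0 := norm_ne_zero_iff.1 (by rw [norm_mul, hx, hz]; norm_num)
  refine ⟨(z * x)⁻¹ * (μ * y), by rw [norm_mul, norm_inv, norm_mul, norm_mul, hx, hy, hz, hμ];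
                                  norm_num, ?_⟩
  rw [mul_smul, mul_smul, ← h, inv_smul_smul₀ hzx]

end LongExactSequence

/-! ### Comparing composites of maps of lines -/

section Lines

variable {A B C D E F : Type*} [AddCommGroup A] [Module ℂ A] [AddCommGroup B] [Module ℂ B]
  [AddCommGroup C] [Module ℂ C] [AddCommGroup D] [Module ℂ D] [AddCommGroup E] [Module ℂ E]
  [AddCommGroup F] [Module ℂ F]
  (p : E ⊗[ℂ] A →ₗ[ℂ] D) (q : F ⊗[ℂ] C →ₗ[ℂ] E) (r : F ⊗[ℂ] B →ₗ[ℂ] D) (s : C ⊗[ℂ] A →ₗ[ℂ] B)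

/-- Two compositions of maps of lines agree up to a factor of modulus one if the maps send
generators to generators up to such factors. -/
theorem exists_comp_rTensor_eq_smul {vA : A} {vB : B} {vC : C} {vD : D} {vE : E} {vF : F}
    (hA : ∀ x, ∃ k : ℂ, k • vA = x) (hC : ∀ x, ∃ k : ℂ, k • vC = x) (hF : ∀ x, ∃ k : ℂ, k • vF = x)
    (hp : ∃ μ : ℂ, ‖μ‖ = 1 ∧ p (vE ⊗ₜ vA) = μ • vD) (hq : ∃ μ : ℂ, ‖μ‖ = 1 ∧ q (vF ⊗ₜ vC) = μ • vE)
    (hr : ∃ μ : ℂ, ‖μ‖ = 1 ∧ r (vF ⊗ₜ vB) = μ • vD)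
    (hs : ∃ μ : ℂ, ‖μ‖ = 1 ∧ s (vC ⊗ₜ vA) = μ • vB) :
    ∃ μ : ℂ, ‖μ‖ = 1 ∧ p.comp (q.rTensor A) =
      μ • (r.comp ((s.lTensor F).comp (TensorProduct.assoc ℂ F C A).toLinearMap)) := by
  obtain ⟨μ₁, hμ₁, e₁⟩ := hp
  obtain ⟨μ₂, hμ₂, e₂⟩ := hq
  obtain ⟨μ₃, hμ₃, e₃⟩ := hr
  obtain ⟨μ₄, hμ₄, e₄⟩ := hs
  have hne : μ₄ * μ₃ ≠ 0 := norm_ne_zero_iff.1 (by rw [norm_mul, hμ₃, hμ₄]; norm_num)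
  -- On `vF ⊗ vC ⊗ vA` the left composite gives `μ₂ * μ₁` times `vD`, the right one `μ₄ * μ₃` times
  -- `vD`.
  refine ⟨μ₂ * μ₁ / (μ₄ * μ₃), by rw [norm_div, norm_mul, norm_mul, hμ₁, hμ₂, hμ₃, hμ₄]; norm_num,
    TensorProduct.ext_threefold fun x y z => ?_⟩
  obtain ⟨x, rfl⟩ := hF x
  obtain ⟨y, rfl⟩ := hC y
  obtain ⟨z, rfl⟩ := hA z
  rw [TensorProduct.smul_tmul_smul, TensorProduct.smul_tmul_smul, map_smul, map_smul]
  congr 1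
  simp only [LinearMap.comp_apply, LinearMap.smul_apply, LinearMap.rTensor_tmul,
    LinearEquiv.coe_coe, TensorProduct.assoc_tmul, LinearMap.lTensor_tmul]
  rw [e₂, e₄, ← TensorProduct.smul_tmul', TensorProduct.tmul_smul, map_smul, map_smul, e₁, e₃,
    smul_smul, smul_smul, smul_smul, mul_assoc _ μ₄, div_mul_cancel₀ _ hne]

/-- For the degenerate case in which `detMap` takes its default value 0: both composites vanish. -/
theorem exists_comp_rTensor_eq_smul_of_zero (hpq : p = 0 ∨ q = 0) (hrs : r = 0 ∨ s = 0) :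
    ∃ μ : ℂ, ‖μ‖ = 1 ∧ p.comp (q.rTensor A) =
      μ • (r.comp ((s.lTensor F).comp (TensorProduct.assoc ℂ F C A).toLinearMap)) := by
  refine ⟨1, norm_one, ?_⟩
  rcases hpq with rfl | rfl <;> rcases hrs with rfl | rfl <;> simp

end Lines

/-! ### Simultaneously adapted bases and the compatibility for a braid -/

namespace ExactBraid

/-- Bases of the terms of an exact braid that are formed by the images of families that decompose
the braid. -/
structure Bases (S : ExactBraid.{u}) extends S.Families where
  A : ∀ i, Module.Basis ((Ps i ⊕ Ph i) ⊕ Al i) ℂ (S.a i)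
  B : ∀ i, Module.Basis (((Ph i ⊕ Al i) ⊕ Rh i) ⊕ Ga i) ℂ (S.b i)
  C : ∀ i, Module.Basis ((Rh i ⊕ Ga i) ⊕ Ps (i + 1)) ℂ (S.c i)
  D : ∀ i, Module.Basis ((Al i ⊕ Ga i) ⊕ Ze i) ℂ (S.d i)
  E : ∀ i, Module.Basis (((Ga i ⊕ Ps (i + 1)) ⊕ Ze i) ⊕ Ph (i + 1)) ℂ (S.e i)
  F : ∀ i, Module.Basis ((Ze i ⊕ Ph (i + 1)) ⊕ Rh (i + 1)) ℂ (S.f i)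
  coe_A : ∀ i, ⇑(A i) = Sum.elim (Sum.elim (ψ' i) (φ' i)) (α i)
  coe_B : ∀ i, ⇑(B i) = Sum.elim (Sum.elim (Sum.elim (fun j => S.ab i (φ' i j))
    fun j => S.ab i (α i j)) (ρ' i)) (γ i)
  coe_C : ∀ i, ⇑(C i) = Sum.elim (Sum.elim (fun j => S.bc i (ρ' i j))
    fun j => S.bc i (γ i j)) (ψ i)
  coe_D : ∀ i, ⇑(D i) = Sum.elim (Sum.elim (fun j => S.ad i (α i j))
    fun j => S.bd i (γ i j)) (ζ i)
  coe_E : ∀ i, ⇑(E i) = Sum.elim (Sum.elim (Sum.elim (fun j => S.de i (S.bd i (γ i j)))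
    fun j => S.ce i (ψ i j)) fun j => S.de i (ζ i j)) (φ i)
  coe_F : ∀ i, ⇑(F i) = Sum.elim (Sum.elim (fun j => S.df i (ζ i j))
    fun j => S.ef i (φ i j)) (ρ i)

theorem Families.nonempty_bases {S : ExactBraid.{u}} (T : S.Families) : Nonempty S.Bases := by
  choose A hA using T.exists_basis_a
  choose B hB using T.exists_basis_b
  choose C hC using T.exists_basis_c
  choose D hD using T.exists_basis_d
  choose E hE using T.exists_basis_e
  choose F hF using T.exists_basis_f
  exact ⟨⟨T, A, B, C, D, E, F, hA, hB, hC, hD, hE, hF⟩⟩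

namespace Bases

variable {S : ExactBraid.{u}} (T : S.Bases)

/-- The adapted bases of the long exact sequence `a → b → c → a[1]`. -/
noncomputable def splitABC : S.abc.SplitBases where
  R := T.Ps
  P i := T.Ph i ⊕ T.Al i
  Q i := T.Rh i ⊕ T.Ga i
  fintypeR := T.fintypePs
  fintypeP _ := inferInstance
  fintypeQ _ := inferInstance
  isEmpty_R := T.isEmpty_Ps
  basisA i := (T.A i).reindex (Equiv.sumAssoc _ _ _)
  basisB i := (T.B i).reindex (Equiv.sumAssoc _ _ _)
  basisC := T.C
  map_a i := by rintro (j | j) <;> simp [T.coe_A, T.coe_B]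
  map_b i := by rintro (j | j) <;> simp [T.coe_B, T.coe_C]
  map_δ i j := by simp [T.coe_C, T.coe_A, T.ca_ψ]

/-- The adapted bases of the long exact sequence `a → d → e → a[1]`. -/
noncomputable def splitADE : S.ade.SplitBases where
  R i := T.Ps i ⊕ T.Ph i
  P := T.Al
  Q i := T.Ga i ⊕ T.Ze i
  fintypeR _ := inferInstance
  fintypeP := T.fintypeAl
  fintypeQ _ := inferInstance
  isEmpty_R := by
    have := T.isEmpty_Ps
    have := T.isEmpty_Ph
    infer_instance
  basisA := T.A
  basisB i := (T.D i).reindex (Equiv.sumAssoc _ _ _)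
  -- The enumeration of `e` follows `c → e → f`. Here `γ`, `ζ` come from `d` while `ψ`, `φ` map on
  -- to `a[1]`, so the two middle blocks are exchanged.
  basisC i := (T.E i).reindex ((Equiv.sumAssoc _ _ _).trans (Equiv.sumSumSumComm _ _ _ _))
  map_a i j := by simp [T.coe_A, T.coe_D]
  map_b i := by rintro (j | j) <;> simp [T.coe_D, T.coe_E]
  map_δ i := by rintro (j | j) <;> simp [T.coe_E, T.coe_A, S.ea_ce, T.ca_ψ, T.ea_φ]

/-- The adapted bases of the long exact sequence `b → d → f → b[1]`. -/
noncomputable def splitBDF : S.bdf.SplitBases where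
  R i := T.Ph i ⊕ T.Rh i
  P i := T.Al i ⊕ T.Ga i
  Q := T.Ze
  fintypeR _ := inferInstance
  fintypeP _ := inferInstance
  fintypeQ := T.fintypeZe
  isEmpty_R := by
    have := T.isEmpty_Ph
    have := T.isEmpty_Rh
    infer_instance
  -- Again the middle blocks are exchanged: `φ'`, `ρ'` come from `f` in the preceding degree, while
  -- `α`, `γ` survive in `d`.
  basisA i := (T.B i).reindex ((Equiv.sumAssoc _ _ _).trans (Equiv.sumSumSumComm _ _ _ _))
  basisB := T.D
  basisC i := (T.F i).reindex (Equiv.sumAssoc _ _ _)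
  map_a i := by rintro (j | j) <;> simp [T.coe_B, T.coe_D, S.bd_ab]
  map_b i j := by simp [T.coe_D, T.coe_F]
  map_δ i := by rintro (j | j) <;> simp [T.coe_F, T.coe_B, ← S.ab_ea, T.ea_φ, T.fb_ρ]

/-- The adapted bases of the long exact sequence `c → e → f → c[1]`. -/
noncomputable def splitCEF : S.cef.SplitBases where
  R := T.Rh
  P i := T.Ga i ⊕ T.Ps (i + 1)
  Q i := T.Ze i ⊕ T.Ph (i + 1)
  fintypeR := T.fintypeRh
  fintypeP _ := inferInstance
  fintypeQ _ := inferInstance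
  isEmpty_R := T.isEmpty_Rh
  basisA i := (T.C i).reindex (Equiv.sumAssoc _ _ _)
  basisB i := (T.E i).reindex (Equiv.sumAssoc _ _ _)
  basisC := T.F
  map_a i := by rintro (j | j) <;> simp [T.coe_C, T.coe_E, S.de_bd]
  map_b i := by rintro (j | j) <;> simp [T.coe_E, T.coe_F, S.ef_de]
  map_δ i j := by simp [T.coe_F, T.coe_C, ← S.bc_fb, T.fb_ρ]

theorem detMap_abc {n : ℕ} (h : S.abc.IsFinite n) :
    ∃ μ : ℂ, ‖μ‖ = 1 ∧ S.abc.detMap n (gradedVol n (fun i => (T.C i).enum) ⊗ₜ[ℂ]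
      gradedVol n (fun i => (T.A i).enum)) = μ • gradedVol n fun i => (T.B i).enum :=
  T.splitABC.detMap_gradedVol_of_reindex T.A T.B T.C (fun _ => Equiv.sumAssoc _ _ _)
    (fun _ => Equiv.sumAssoc _ _ _) (fun _ => Equiv.refl _) (fun _ => rfl) (fun _ => rfl)
    (fun i => (T.C i).reindex_refl.symm) h

theorem detMap_ade {n : ℕ} (h : S.ade.IsFinite n) :
    ∃ μ : ℂ, ‖μ‖ = 1 ∧ S.ade.detMap n (gradedVol n (fun i => (T.E i).enum) ⊗ₜ[ℂ]
      gradedVol n (fun i => (T.A i).enum)) = μ • gradedVol n fun i => (T.D i).enum :=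
  T.splitADE.detMap_gradedVol_of_reindex T.A T.D T.E (fun _ => Equiv.refl _)
    (fun _ => Equiv.sumAssoc _ _ _)
    (fun _ => (Equiv.sumAssoc _ _ _).trans (Equiv.sumSumSumComm _ _ _ _))
    (fun i => (T.A i).reindex_refl.symm) (fun _ => rfl) (fun _ => rfl) h

theorem detMap_bdf {n : ℕ} (h : S.bdf.IsFinite n) :
    ∃ μ : ℂ, ‖μ‖ = 1 ∧ S.bdf.detMap n (gradedVol n (fun i => (T.F i).enum) ⊗ₜ[ℂ]
      gradedVol n (fun i => (T.B i).enum)) = μ • gradedVol n fun i => (T.D i).enum :=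
  T.splitBDF.detMap_gradedVol_of_reindex T.B T.D T.F
    (fun _ => (Equiv.sumAssoc _ _ _).trans (Equiv.sumSumSumComm _ _ _ _)) (fun _ => Equiv.refl _)
    (fun _ => Equiv.sumAssoc _ _ _) (fun _ => rfl) (fun i => (T.D i).reindex_refl.symm)
    (fun _ => rfl) h

theorem detMap_cef {n : ℕ} (h : S.cef.IsFinite n) :
    ∃ μ : ℂ, ‖μ‖ = 1 ∧ S.cef.detMap n (gradedVol n (fun i => (T.F i).enum) ⊗ₜ[ℂ]
      gradedVol n (fun i => (T.C i).enum)) = μ • gradedVol n fun i => (T.E i).enum :=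
  T.splitCEF.detMap_gradedVol_of_reindex T.C T.E T.F (fun _ => Equiv.sumAssoc _ _ _)
    (fun _ => Equiv.sumAssoc _ _ _) (fun _ => Equiv.refl _) (fun _ => rfl) (fun _ => rfl)
    (fun i => (T.F i).reindex_refl.symm) h

end Bases

theorem finite_of_exact {U V W : ModuleCat.{u} ℂ} {g : U →ₗ[ℂ] V} {h : V →ₗ[ℂ] W}
    (H : Function.Exact g h) (_ : FiniteDimensional ℂ U) (_ : FiniteDimensional ℂ W) :
    FiniteDimensional ℂ V := by
  have := isNoetherian_of_range_eq_ker g h H.linearMap_ker_eq.symm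
  infer_instance

theorem subsingleton_of_exact {U V W : ModuleCat.{u} ℂ} {g : U →ₗ[ℂ] V} {h : V →ₗ[ℂ] W}
    (H : Function.Exact g h) (_ : Subsingleton U) (_ : Subsingleton W) : Subsingleton V := by
  refine subsingleton_of_forall_eq 0 fun x => ?_
  obtain ⟨y, rfl⟩ := (H x).1 (Subsingleton.elim _ _)
  rw [Subsingleton.elim y 0, map_zero]

variable (S : ExactBraid.{u}) {n : ℕ}

/-- Only `b` is missing from the two given sequences, and exactness squeezes it between `a` and `c`.
-/
theorem isFinite_abc_bdf (h₁ : S.ade.IsFinite n) (h₂ : S.cef.IsFinite n) :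
    S.abc.IsFinite n ∧ S.bdf.IsFinite n := by
  have hb : ∀ i, FiniteDimensional ℂ (S.b i) := fun i =>
    finite_of_exact (S.exact_ab_bc i) (h₁.finA i) (h₂.finA i)
  have hb' : ∀ i, n < i → Subsingleton (S.b i) := fun i hi =>
    subsingleton_of_exact (S.exact_ab_bc i) (h₁.zeroA i hi) (h₂.zeroA i hi)
  exact ⟨⟨h₁.finA, hb, h₂.finA, h₁.zeroA, hb', h₂.zeroA⟩,
    ⟨hb, h₁.finB, h₂.finC, hb', h₁.zeroB, h₂.zeroC⟩⟩

/-- Only `e` is missing here, and it is squeezed between `c` and `f`. -/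
theorem isFinite_ade_cef (h₁ : S.abc.IsFinite n) (h₂ : S.bdf.IsFinite n) :
    S.ade.IsFinite n ∧ S.cef.IsFinite n := by
  have he : ∀ i, FiniteDimensional ℂ (S.e i) := fun i =>
    finite_of_exact (S.exact_ce_ef i) (h₁.finC i) (h₂.finC i)
  have he' : ∀ i, n < i → Subsingleton (S.e i) := fun i hi =>
    subsingleton_of_exact (S.exact_ce_ef i) (h₁.zeroC i hi) (h₂.zeroC i hi)
  exact ⟨⟨h₁.finA, h₂.finB, he, h₁.zeroA, h₂.zeroB, he'⟩,
    ⟨h₁.finC, he, h₂.finC, h₁.zeroC, he', h₂.zeroC⟩⟩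

/-- The isomorphisms of determinant lines of the four long exact sequences of a braid are compatible
up to a factor of modulus one. No finiteness is assumed: by exactness, the two sequences on the left
are finite if and only if those on the right are, and otherwise both sides vanish. -/
theorem exists_detMap_comp_eq_smul (n : ℕ) : ∃ μ : ℂ, ‖μ‖ = 1 ∧
    (S.ade.detMap n).comp ((S.cef.detMap n).rTensor (GradedDet n S.a)) =
      μ • ((S.bdf.detMap n).comp (((S.abc.detMap n).lTensor (GradedDet n S.f)).comp
        (TensorProduct.assoc ℂ (GradedDet n S.f) (GradedDet n S.c)
          (GradedDet n S.a)).toLinearMap)) := by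
  by_cases hfin : S.ade.IsFinite n ∧ S.cef.IsFinite n
  · obtain ⟨h₁, h₂⟩ := hfin
    obtain ⟨h₃, h₄⟩ := S.isFinite_abc_bdf h₁ h₂
    obtain ⟨T₀⟩ := S.nonempty_families h₃.finA h₃.finB h₃.finC h₁.finB h₁.finC h₂.finC
    obtain ⟨T⟩ := T₀.nonempty_bases
    exact exists_comp_rTensor_eq_smul _ _ _ _
      (fun x => ⟨_, gradedVolCoord_smul_gradedVol n (fun i => (T.A i).enum) x⟩)
      (fun x => ⟨_, gradedVolCoord_smul_gradedVol n (fun i => (T.C i).enum) x⟩)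
      (fun x => ⟨_, gradedVolCoord_smul_gradedVol n (fun i => (T.F i).enum) x⟩)
      (T.detMap_ade h₁) (T.detMap_cef h₂) (T.detMap_bdf h₄) (T.detMap_abc h₃)
  · have hfin' : ¬ (S.bdf.IsFinite n ∧ S.abc.IsFinite n) := fun h =>
      hfin (S.isFinite_ade_cef h.2 h.1)
    have h0 (L : LongExactSequence.{u}) (hL : ¬ L.IsFinite n) : L.detMap n = 0 := dif_neg hL
    exact exists_comp_rTensor_eq_smul_of_zero _ _ _ _ ((not_and_or.1 hfin).imp (h0 _) (h0 _))
      ((not_and_or.1 hfin').imp (h0 _) (h0 _))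

end ExactBraid

/-! ### The braid of a filtration of spaces -/

namespace FlatVectorBundle

variable {X : Type u} [TopologicalSpace X] {r : ℕ} {ι : Type*} (F : FlatVectorBundle X r ι)

theorem complexIncl_comp (R : Set X) {P Q Q' : Set X} (h : P ⊆ Q) (h' : Q ⊆ Q') :
    F.complexIncl R h' ≫ F.complexIncl R h = F.complexIncl R (h.trans h') := by
  ext k : 2
  rfl

theorem complexRestr_comp {R Q Q' : Set X} (h : Q ⊆ Q') (h' : Q' ⊆ R) (P : Set X) :
    F.complexRestr h' P ≫ F.complexRestr h P = F.complexRestr (h.trans h') P := by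
  ext k : 2
  rfl

theorem complexIncl_complexRestr {P P' Q R : Set X} (h : P ⊆ P') (h' : Q ⊆ R) :
    F.complexIncl R h ≫ F.complexRestr h' P = F.complexRestr h' P' ≫ F.complexIncl Q h := by
  ext k : 2
  rfl

/-- The map of short exact sequences of triples given by enlarging the smallest space. -/
noncomputable def tripleSequenceIncl {P P' Q R : Set X} (h : P ⊆ P') (hPQ : P' ⊆ Q) (hQR : Q ⊆ R) :
    F.tripleSequence hPQ hQR ⟶ F.tripleSequence (h.trans hPQ) hQR where
  τ₁ := 𝟙 _
  τ₂ := F.complexIncl R h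
  τ₃ := F.complexIncl Q h
  comm₁₂ := (Category.id_comp _).trans (F.complexIncl_comp R h hPQ).symm
  comm₂₃ := F.complexIncl_complexRestr h hQR

/-- The map of short exact sequences of triples given by enlarging the middle space. -/
noncomputable def tripleSequenceMid {P Q Q' R : Set X} (hPQ : P ⊆ Q) (h : Q ⊆ Q') (hQR : Q' ⊆ R) :
    F.tripleSequence (hPQ.trans h) hQR ⟶ F.tripleSequence hPQ (h.trans hQR) where
  τ₁ := F.complexIncl R h
  τ₂ := 𝟙 _
  τ₃ := F.complexRestr h P
  comm₁₂ := (F.complexIncl_comp R hPQ h).trans (Category.comp_id _).symm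
  comm₂₃ := (Category.id_comp _).trans (F.complexRestr_comp h hQR P).symm

/-- The map of short exact sequences of triples given by shrinking the largest space. -/
noncomputable def tripleSequenceRestr {P Q R R' : Set X} (hPQ : P ⊆ Q) (hQR : Q ⊆ R) (h : R ⊆ R') :
    F.tripleSequence hPQ (hQR.trans h) ⟶ F.tripleSequence hPQ hQR where
  τ₁ := F.complexRestr h Q
  τ₂ := F.complexRestr h P
  τ₃ := 𝟙 _
  comm₁₂ := (F.complexIncl_complexRestr hPQ h).symm
  comm₂₃ := (F.complexRestr_comp hQR h P).trans (Category.comp_id _).symm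

theorem homologyMap_comp_apply {K L M : CochainComplex (ModuleCat.{u} ℂ) ℕ} {f : K ⟶ L} {g : L ⟶ M}
    {h : K ⟶ M} (e : f ≫ g = h) (i : ℕ) (x : K.homology i) :
    (HomologicalComplex.homologyMap g i).hom ((HomologicalComplex.homologyMap f i).hom x) =
      (HomologicalComplex.homologyMap h i).hom x := by
  subst e
  rw [HomologicalComplex.homologyMap_comp]
  rfl

theorem δ_naturality_apply {S T : ShortComplex (CochainComplex (ModuleCat.{u} ℂ) ℕ)} (φ : S ⟶ T)
    (hS : S.ShortExact) (hT : T.ShortExact) (i : ℕ) (x : S.X₃.homology i) :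
    (HomologicalComplex.homologyMap φ.τ₁ (i + 1)).hom ((hS.δ i (i + 1) rfl).hom x) =
      (hT.δ i (i + 1) rfl).hom ((HomologicalComplex.homologyMap φ.τ₃ i).hom x) :=
  LinearMap.congr_fun (congrArg ModuleCat.Hom.hom
    (HomologicalComplex.HomologySequence.δ_naturality φ hS hT i (i + 1) rfl)) x

theorem homologyMap_id_apply (K : CochainComplex (ModuleCat.{u} ℂ) ℕ) (i : ℕ) (x : K.homology i) :
    (HomologicalComplex.homologyMap (𝟙 K) i).hom x = x := by
  rw [HomologicalComplex.homologyMap_id]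
  rfl

/-- The braid formed by the long exact cohomology sequences of the four triples contained in a
filtration `P ⊆ Q ⊆ R ⊆ S`. -/
noncomputable def braid {P Q R S : Set X} (hPQ : P ⊆ Q) (hQR : Q ⊆ R) (hRS : R ⊆ S) :
    ExactBraid.{u} where
  a := F.cohomology S R
  b := F.cohomology S Q
  c := F.cohomology R Q
  d := F.cohomology S P
  e := F.cohomology R P
  f := F.cohomology Q P
  ab := (F.longExactSequence hQR hRS).a
  bc := (F.longExactSequence hQR hRS).b
  ca := (F.longExactSequence hQR hRS).δ
  ad := (F.longExactSequence (hPQ.trans hQR) hRS).a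
  de := (F.longExactSequence (hPQ.trans hQR) hRS).b
  ea := (F.longExactSequence (hPQ.trans hQR) hRS).δ
  bd := (F.longExactSequence hPQ (hQR.trans hRS)).a
  df := (F.longExactSequence hPQ (hQR.trans hRS)).b
  fb := (F.longExactSequence hPQ (hQR.trans hRS)).δ
  ce := (F.longExactSequence hPQ hQR).a
  ef := (F.longExactSequence hPQ hQR).b
  fc := (F.longExactSequence hPQ hQR).δ
  injective_ab := (F.longExactSequence hQR hRS).injective_a
  injective_ad := (F.longExactSequence (hPQ.trans hQR) hRS).injective_a
  injective_bd := (F.longExactSequence hPQ (hQR.trans hRS)).injective_a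
  injective_ce := (F.longExactSequence hPQ hQR).injective_a
  exact_ab_bc := (F.longExactSequence hQR hRS).exact_a_b
  exact_bc_ca := (F.longExactSequence hQR hRS).exact_b_δ
  exact_ca_ab := (F.longExactSequence hQR hRS).exact_δ_a
  exact_ad_de := (F.longExactSequence (hPQ.trans hQR) hRS).exact_a_b
  exact_de_ea := (F.longExactSequence (hPQ.trans hQR) hRS).exact_b_δ
  exact_ea_ad := (F.longExactSequence (hPQ.trans hQR) hRS).exact_δ_a
  exact_bd_df := (F.longExactSequence hPQ (hQR.trans hRS)).exact_a_b
  exact_df_fb := (F.longExactSequence hPQ (hQR.trans hRS)).exact_b_δ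
  exact_fb_bd := (F.longExactSequence hPQ (hQR.trans hRS)).exact_δ_a
  exact_ce_ef := (F.longExactSequence hPQ hQR).exact_a_b
  exact_ef_fc := (F.longExactSequence hPQ hQR).exact_b_δ
  exact_fc_ce := (F.longExactSequence hPQ hQR).exact_δ_a
  bd_ab := homologyMap_comp_apply (F.complexIncl_comp S hPQ hQR)
  de_bd i x := (homologyMap_comp_apply (F.complexIncl_complexRestr hPQ hRS) i x).trans
    (homologyMap_comp_apply rfl i x).symm
  ef_de := homologyMap_comp_apply (F.complexRestr_comp hQR hRS P)
  -- The three relations with connecting maps are naturality of `δ` for the maps between triples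
  -- that change one space; the first and the last have an identity at one end, which is removed.
  ea_ce i x := (δ_naturality_apply (F.tripleSequenceIncl hPQ hQR hRS)
    (F.tripleSequence_shortExact hQR hRS) (F.tripleSequence_shortExact (hPQ.trans hQR) hRS)
    i x).symm.trans (homologyMap_id_apply _ _ _)
  ab_ea := δ_naturality_apply (F.tripleSequenceMid hPQ hQR hRS)
    (F.tripleSequence_shortExact (hPQ.trans hQR) hRS)
    (F.tripleSequence_shortExact hPQ (hQR.trans hRS))
  bc_fb i x := (δ_naturality_apply (F.tripleSequenceRestr hPQ hQR hRS)
    (F.tripleSequence_shortExact hPQ (hQR.trans hRS)) (F.tripleSequence_shortExact hPQ hQR)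
    i x).trans (congrArg _ (homologyMap_id_apply _ _ _))

end FlatVectorBundle

/-- `Y₃` is a compact smooth manifold with boundary, modelled on `I` (for instance `𝓡∂ m`, or `𝓡 0` in
dimension zero); `Y₁` and `Y₂` are subsets of `Y₃` that are compact smooth manifolds with boundary of
the same dimension and whose inclusions in `Y₃` are smooth embeddings, with `Y₁ ⊆ int Y₂` and
`Y₂ ⊆ int Y₃`; `F` is a flat complex vector bundle of rank `r` on `Y₃`. With the canonical isomorphisms
`f_{1,21} : det H(Y₁) ⊗ det H(Y₂, Y₁) ≅ det H(Y₂)`,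
`f_{2,32} : det H(Y₂) ⊗ det H(Y₃, Y₂) ≅ det H(Y₃)`,
`f_{1,31} : det H(Y₁) ⊗ det H(Y₃, Y₁) ≅ det H(Y₃)`,
`f_{21,32} : det H(Y₂, Y₁) ⊗ det H(Y₃, Y₂) ≅ det H(Y₃, Y₁)`
of the triples of spaces, `f_{2,32} ∘ (f_{1,21} ⊗ id) = μ f_{1,31} ∘ (id ⊗ f_{21,32})` for some complex
number `μ` of modulus one. -/
theorem proposition1p1 {E : Type*} [NormedAddCommGroup E] [NormedSpace ℝ E] [FiniteDimensional ℝ E]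
    {H : Type*} [TopologicalSpace H] (I : ModelWithCorners ℝ E H)
    {Y₃ : Type*} [TopologicalSpace Y₃] [T2Space Y₃] [CompactSpace Y₃]
    [ChartedSpace H Y₃] [IsManifold I ∞ Y₃]
    (Y₁ Y₂ : Set Y₃) [CompactSpace Y₁] [CompactSpace Y₂]
    [ChartedSpace H Y₁] [IsManifold I ∞ Y₁] [ChartedSpace H Y₂] [IsManifold I ∞ Y₂]
    (_smooth₁ : ContMDiff I I ∞ (Subtype.val : Y₁ → Y₃))
    (_immersion₁ : ∀ y : Y₁, Function.Injective (mfderiv I I (Subtype.val : Y₁ → Y₃) y))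
    (_smooth₂ : ContMDiff I I ∞ (Subtype.val : Y₂ → Y₃))
    (_immersion₂ : ∀ y : Y₂, Function.Injective (mfderiv I I (Subtype.val : Y₂ → Y₃) y))
    (h₁₂ : Y₁ ⊆ Y₂)
    (_interior₁₂ : ∀ y (hy : y ∈ Y₁), (⟨y, h₁₂ hy⟩ : Y₂) ∈ I.interior Y₂)
    (_interior₂₃ : Y₂ ⊆ I.interior Y₃)
    {r : ℕ} {ι : Type*} (F : FlatVectorBundle Y₃ r ι) :
    ∃ μ : ℂ, ‖μ‖ = 1 ∧
      (F.fusion (Module.finrank ℝ E) (empty_subset Y₂) (subset_univ Y₂)).comp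
          ((F.fusion (Module.finrank ℝ E) (empty_subset Y₁) h₁₂).rTensor
            (GradedDet (Module.finrank ℝ E) (F.cohomology univ Y₂))) =
        μ • ((F.fusion (Module.finrank ℝ E) (empty_subset Y₁) (subset_univ Y₁)).comp
          (((F.fusion (Module.finrank ℝ E) h₁₂ (subset_univ Y₂)).lTensor
            (GradedDet (Module.finrank ℝ E) (F.cohomology Y₁ ∅))).comp
            (TensorProduct.assoc ℂ (GradedDet (Module.finrank ℝ E) (F.cohomology Y₁ ∅))
              (GradedDet (Module.finrank ℝ E) (F.cohomology Y₂ Y₁))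
              (GradedDet (Module.finrank ℝ E) (F.cohomology univ Y₂))).toLinearMap)) :=
  -- In this braid `ade`, `cef`, `bdf`, `abc` are the sequences defining `f_{2,32}`, `f_{1,21}`,
  -- `f_{1,31}`, `f_{21,32}`, so the compatibility for braids is the claim by definition.
  (F.braid (empty_subset Y₁) h₁₂ (subset_univ Y₂)).exists_detMap_comp_eq_smul (Module.finrank ℝ E)
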